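/- Let $(\mathbb M,g)$ be a smooth Riemannian manifold of dimension $n+m$ with Levi-Civita connection $\nabla^R$, equipped with an $m$-dimensional foliation (locally given by the fibres of smooth submersions onto open subsets of $\mathbb R^n$) for which $g$ is bundle-like (the local submersions are Riemannian submersions for suitable metrics on their images) and whose leaves are totally geodesic. Let $\mathcal V$ be the bundle tangent to the leaves, $\mathcal H=\mathcal V^{\perp}$, with orthogonal projections $\pi_{\mathcal V},\pi_{\mathcal H}$, and let $\nabla$ be the Bott connection: $\nabla_XY=\pi_{\mathcal H}(\nabla^R_XY)$ for $X,Y\in\Gamma^\infty(\mathcal H)$, $\pi_{\mathcal H}([X,Y])$ for $X\in\Gamma^\infty(\mathcal V),Y\in\Gamma^\infty(\mathcal H)$, $\pi_{\mathcal V}([X,Y])$ for $X\in\Gamma^\infty(\mathcal H),Y\in\Gamma^\infty(\mathcal V)$, $\pi_{\mathcal V}(\nabla^R_XY)$ for $X,Y\in\Gamma^\infty(\mathcal V)$. Let $T(X,Y)=\nabla_XY-\nabla_YX-[X,Y]$ be its torsion. For a tangent vector $Z$, let $J_Z$ be the endomorphism of $T\mathbb M$ which vanishes on $\mathcal V$,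 takes values in $\mathcal H$, and satisfies $g(J_ZX,Y)=g(\pi_{\mathcal V}Z,T(X,Y))$ for $X,Y\in\mathcal H$. For $\varepsilon>0$ put $$\nabla^\varepsilon_XY=\nabla_XY-T(X,Y)+\tfrac1\varepsilon J_YX,\qquad \widehat\nabla^\varepsilon_XY=\nabla_XY+\tfrac1\varepsilon J_XY ;$$ $\widehat\nabla^\varepsilon$ is the adjoint connection of $\nabla^\varepsilon$, that is, $\widehat\nabla^\varepsilon_XY=\nabla^\varepsilon_XY-T^\varepsilon(X,Y)$ with $T^\varepsilon$ the torsion of $\nabla^\varepsilon$. With local orthonormal frames $X_1,\dots,X_n$ of $\mathcal H$ and $Z_1,\dots,Z_m$ of $\mathcal V$, put $$\mathbf J^2=\sum_{\ell=1}^m J_{Z_\ell}J_{Z_\ell},\qquad \delta_{\mathcal H}T(X)=\sum_{j=1}^n(\nabla_{X_j}T)(X_j,X),$$ and let $\delta_{\mathcal H}^*T$ be the adjoint of the endomorphism $\delta_{\mathcal H}T$ with respect to $g$. Endomorphisms $A$ of $T\mathbb M$ act on one-forms by $\eta\mapsto(A\eta^\sharp)^\flat$, with $\sharp,\flat$ taken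 with respect to $g$. The horizontal Ricci curvature of a connection with curvature $R(X,Y)Z=\nabla_X\nabla_YZ-\nabla_Y\nabla_XZ-\nabla_{[X,Y]}Z$ is $\mathbf{Ric}_{\mathcal H}(X,Y)=\sum_{i=1}^n g(R(X_i,X)Y,X_i)$, $X,Y\in T\mathbb M$; it is viewed as the linear map $\mathfrak{Ric}_{\mathcal H}$ on one-forms with $\langle\mathfrak{Ric}_{\mathcal H}\,\eta,\xi\rangle_g=\mathbf{Ric}_{\mathcal H}(\eta^\sharp,\xi^\sharp)$. Denote by $\mathfrak{Ric}_{\mathcal H}$ and $\widehat{\mathfrak{Ric}}{}^{\varepsilon}_{\mathcal H}$ these maps for $\nabla$ and $\widehat\nabla^\varepsilon$. Then, at every point of $\mathbb M$ and for every $\varepsilon>0$, $$\widehat{\mathfrak{Ric}}{}^{\varepsilon}_{\mathcal H}=\mathfrak{Ric}_{\mathcal H}-\frac1\varepsilon\,\delta_{\mathcal H}^*T+\frac1\varepsilon\,\mathbf J^2 .$$ Moreover, the $g$-adjoint of $\widehat{\mathfrak{Ric}}{}^{\varepsilon}_{\mathcal H}$ is the operator $\mathfrak{Ric}_{\mathcal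 H}-\frac1\varepsilon\delta_{\mathcal H}T+\frac1\varepsilon\mathbf J^2$ on one-forms, i.e. the potential term in $$\square_\varepsilon=\sum_{i=1}^n\big(\nabla^\varepsilon_{X_i}\nabla^\varepsilon_{X_i}-\nabla^\varepsilon_{\nabla_{X_i}X_i}\big)-\Big(\mathfrak{Ric}_{\mathcal H}-\frac1\varepsilon\delta_{\mathcal H}T+\frac1\varepsilon\mathbf J^2\Big),$$ the operator of the Weitzenböck formula $dLf=\square_\varepsilon df$ for the horizontal Laplacian $L$. -/

import Mathlib

open Bundle Manifold VectorField
open scoped ContDiff Topology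

noncomputable section

namespace RiemannianFoliation

/-- The tangent space at `x` of a manifold modelled on `E`. -/
abbrev Tan (E : Type*) [NormedAddCommGroup E] [NormedSpace ℝ E]
    {M : Type*} [TopologicalSpace M] [ChartedSpace E M] (x : M) : Type _ :=
  TangentSpace 𝓘(ℝ, E) x

/-- A foliation of codimension `n` of a manifold modelled on `E` (so the leaves have dimension `m`
when `E` has dimension `n + m`), given by a collection of
pairs `(U, π)` where `U` is open and `π : U → ℝⁿ` is a smooth submersion (only the values of `π`
on `U` matter). The sets `U` cover the manifold, and on overlaps the submersions differ by
local diffeomorphisms of `ℝⁿ`. -/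
structure Foliation (n : ℕ) (E : Type*) [NormedAddCommGroup E] [NormedSpace ℝ E]
    (M : Type*) [TopologicalSpace M] [ChartedSpace E M] where
  charts : Set (Set M × (M → EuclideanSpace ℝ (Fin n)))
  isOpen : ∀ c ∈ charts, IsOpen c.1
  smooth : ∀ c ∈ charts, ContMDiffOn 𝓘(ℝ, E) (𝓡 n) ∞ c.2 c.1
  submersion : ∀ c ∈ charts, ∀ x ∈ c.1,
    Function.Surjective (mfderiv 𝓘(ℝ, E) (𝓡 n) c.2 x)
  cover : ∀ x : M, ∃ c ∈ charts, x ∈ c.1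
  transition : ∀ c ∈ charts, ∀ c' ∈ charts, ∀ x ∈ c.1 ∩ c'.1,
    ∃ ψ : EuclideanSpace ℝ (Fin n) → EuclideanSpace ℝ (Fin n),
      IsLocalDiffeomorphAt (𝓡 n) (𝓡 n) ∞ ψ (c'.2 x) ∧ ∀ᶠ y in 𝓝 x, c.2 y = ψ (c'.2 y)

section

variable {n : ℕ} {E : Type*} [NormedAddCommGroup E] [NormedSpace ℝ E] [FiniteDimensional ℝ E]
  {M : Type*} [TopologicalSpace M] [ChartedSpace E M]

/-- The vertical space `𝓥 x`: the common kernel of the differentials at `x` of the submersions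
defining the foliation (they all have the same kernel). -/
def Foliation.vertical (F : Foliation n E M) (x : M) : Submodule ℝ (Tan E x) :=
  ⨅ c ∈ F.charts, ⨅ _ : x ∈ c.1, (mfderiv 𝓘(ℝ, E) (𝓡 n) c.2 x).ker

instance (x : M) : FiniteDimensional ℝ (Tan E x) :=
  inferInstanceAs (FiniteDimensional ℝ E)

variable [RiemannianBundle (fun x : M ↦ TangentSpace 𝓘(ℝ, E) x)]

/-- The horizontal space `𝓗 x`, normal to the vertical space. -/
def Foliation.horizontal (F : Foliation n E M) (x : M) : Submodule ℝ (Tan E x) :=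
  (F.vertical x)ᗮ

/-- The orthogonal projection onto the vertical space. -/
def Foliation.ver (F : Foliation n E M) (x : M) : Tan E x →L[ℝ] Tan E x :=
  (F.vertical x).starProjection

/-- The orthogonal projection onto the horizontal space. -/
def Foliation.hor (F : Foliation n E M) (x : M) : Tan E x →L[ℝ] Tan E x :=
  (F.horizontal x).starProjection

/-- The metric is bundle-like: each `π : U → π(U)` is a Riemannian submersion for a suitable
Riemannian metric `h` on the open set `π(U) ⊆ ℝⁿ`, that is, the differential of `π` restricts to
isometries on the horizontal spaces. -/
def Foliation.IsBundleLike (F : Foliation n E M) : Prop :=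
  ∀ c ∈ F.charts,
    ∃ h : EuclideanSpace ℝ (Fin n) →
        EuclideanSpace ℝ (Fin n) →L[ℝ] EuclideanSpace ℝ (Fin n) →L[ℝ] ℝ,
      ContDiffOn ℝ ∞ h (c.2 '' c.1) ∧
      (∀ y ∈ c.2 '' c.1, (∀ a b, h y a b = h y b a) ∧ ∀ a, a ≠ 0 → 0 < h y a a) ∧
      ∀ x ∈ c.1, ∀ u ∈ F.horizontal x, ∀ v ∈ F.horizontal x,
        h (c.2 x) (mfderiv 𝓘(ℝ, E) (𝓡 n) c.2 x u) (mfderiv 𝓘(ℝ, E) (𝓡 n) c.2 x v) =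
          inner ℝ u v

end

section

variable {n : ℕ} {E : Type*} [NormedAddCommGroup E] [NormedSpace ℝ E] [FiniteDimensional ℝ E]
  {M : Type*} [TopologicalSpace M] [ChartedSpace E M]
  [IsManifold 𝓘(ℝ, E) ∞ M]
  [RiemannianBundle (fun x : M ↦ TangentSpace 𝓘(ℝ, E) x)]
  [IsContMDiffRiemannianBundle 𝓘(ℝ, E) ∞ E
    (fun x : M ↦ TangentSpace 𝓘(ℝ, E) x)]

/-- `D` is the Levi-Civita connection: it is smooth, metric and torsion-free.
In Mathlib's convention `D Y x v` is `(∇_v Y)(x)`. -/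
structure IsLeviCivita
    (D : CovariantDerivative 𝓘(ℝ, E) E
      (fun x : M ↦ TangentSpace 𝓘(ℝ, E) x)) : Prop where
  smooth : ∀ U : Set M, IsOpen U → ContMDiffCovariantDerivativeOn E ∞ D.toFun U
  metric : ∀ (x : M) (Y Z : Π y : M, TangentSpace 𝓘(ℝ, E) y) (v : TangentSpace 𝓘(ℝ, E) x),
    MDiffAt (T% Y) x → MDiffAt (T% Z) x →
    mvfderiv 𝓘(ℝ, E) (fun y ↦ (inner ℝ (Y y) (Z y) : ℝ)) x v =
      inner ℝ (D Y x v) (Z x) + inner ℝ (Y x) (D Z x v)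
  torsion : D.torsion = 0

/-- The leaves are totally geodesic: their second fundamental form vanishes, that is,
`∇ᴿ_X Y` is vertical for all (local) vertical vector fields `X`, `Y`. -/
def Foliation.IsTotallyGeodesic (F : Foliation n E M)
    (D : CovariantDerivative 𝓘(ℝ, E) E
      (fun x : M ↦ TangentSpace 𝓘(ℝ, E) x)) : Prop :=
  ∀ (U : Set M) (X Y : Π x : M, TangentSpace 𝓘(ℝ, E) x), IsOpen U →
    ContMDiffOn 𝓘(ℝ, E) 𝓘(ℝ, E).tangent ∞
      (fun x ↦ (⟨x, X x⟩ : TangentBundle 𝓘(ℝ, E) M)) U →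
    ContMDiffOn 𝓘(ℝ, E) 𝓘(ℝ, E).tangent ∞
      (fun x ↦ (⟨x, Y x⟩ : TangentBundle 𝓘(ℝ, E) M)) U →
    (∀ x ∈ U, X x ∈ F.vertical x) → (∀ x ∈ U, Y x ∈ F.vertical x) →
    ∀ x ∈ U, D Y x (X x) ∈ F.vertical x

end

section

variable {n : ℕ} {E : Type*} [NormedAddCommGroup E] [NormedSpace ℝ E] [FiniteDimensional ℝ E]
  {M : Type*} [TopologicalSpace M] [ChartedSpace E M]
  [IsManifold 𝓘(ℝ, E) ∞ M]
  [RiemannianBundle (fun x : M ↦ TangentSpace 𝓘(ℝ, E) x)]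
  (F : Foliation n E M)
  (D : CovariantDerivative 𝓘(ℝ, E) E (fun x : M ↦ TangentSpace 𝓘(ℝ, E) x))

/-- The Bott connection `∇_X Y`, where `D` is the Levi-Civita connection:
`π_𝓗 (∇ᴿ_X Y)` for `X`, `Y` horizontal, `π_𝓗 [X, Y]` for `X` vertical and `Y` horizontal,
`π_𝓥 [X, Y]` for `X` horizontal and `Y` vertical, `π_𝓥 (∇ᴿ_X Y)` for `X`, `Y` vertical. -/
def bott (X Y : Π x : M, Tan E x) : Π x : M, Tan E x := fun x ↦
  F.hor x (D (fun y ↦ F.hor y (Y y)) x (F.hor x (X x)))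
  + F.hor x (mlieBracket 𝓘(ℝ, E) (fun y ↦ F.ver y (X y)) (fun y ↦ F.hor y (Y y)) x)
  + F.ver x (mlieBracket 𝓘(ℝ, E) (fun y ↦ F.hor y (X y)) (fun y ↦ F.ver y (Y y)) x)
  + F.ver x (D (fun y ↦ F.ver y (Y y)) x (F.ver x (X x)))

/-- The torsion `T(X, Y) = ∇_X Y - ∇_Y X - [X, Y]` of the Bott connection, on vector fields. -/
def bottTorsion (X Y : Π x : M, Tan E x) : Π x : M, Tan E x :=
  bott F D X Y - bott F D Y X - mlieBracket 𝓘(ℝ, E) X Y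

/-- A vector field, smooth near `x`, with value `v` at `x`. -/
abbrev ext {x : M} (v : Tan E x) : Π y : M, Tan E y :=
  FiberBundle.extend E (E := fun y : M ↦ TangentSpace 𝓘(ℝ, E) y) v

/-- The torsion tensor of the Bott connection at `x`. -/
def torsionAt (x : M) (u v : Tan E x) : Tan E x := bottTorsion F D (ext u) (ext v) x

/-- The derivative `(∇_W T)(X, Y) = ∇_W (T(X, Y)) - T(∇_W X, Y) - T(X, ∇_W Y)` of the torsion of
the Bott connection, on vector fields. -/
def covTorsion (W X Y : Π x : M, Tan E x) : Π x : M, Tan E x :=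
  bott F D W (bottTorsion F D X Y) - bottTorsion F D (bott F D W X) Y
    - bottTorsion F D X (bott F D W Y)

/-- An orthonormal basis of the horizontal space at `x`. -/
def horBasis (x : M) :
    OrthonormalBasis (Fin (Module.finrank ℝ (F.horizontal x))) ℝ (F.horizontal x) :=
  stdOrthonormalBasis ℝ (F.horizontal x)

/-- An orthonormal basis of the vertical space at `x`. -/
def verBasis (x : M) :
    OrthonormalBasis (Fin (Module.finrank ℝ (F.vertical x))) ℝ (F.vertical x) :=
  stdOrthonormalBasis ℝ (F.vertical x)

/-- An orthonormal basis of the tangent space at `x`. -/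
def tanBasis (x : M) : OrthonormalBasis (Fin (Module.finrank ℝ (Tan E x))) ℝ (Tan E x) :=
  stdOrthonormalBasis ℝ (Tan E x)

/-- The endomorphism `J_Z` of the tangent space at `x`, written in an orthonormal basis of the
horizontal space: `⟨J_Z X, Y⟩ = ⟨π_𝓥 Z, T(X, Y)⟩` for `X`, `Y` horizontal, `J_Z` takes
horizontal values and vanishes on vertical vectors. In particular `J_Z = 0` for `Z` horizontal. -/
def J (x : M) (Z : Tan E x) : Tan E x →L[ℝ] Tan E x :=
  ∑ i, ∑ j, inner ℝ (F.ver x Z)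
      (torsionAt F D x (horBasis F x i : Tan E x) (horBasis F x j : Tan E x)) •
    (innerSL ℝ (horBasis F x i : Tan E x)).smulRight (horBasis F x j : Tan E x)

/-- The endomorphism `𝐉² = ∑ J_{Z_l} J_{Z_l}`, for an orthonormal basis `Z_l` of the vertical
space. -/
def JSq (x : M) : Tan E x →L[ℝ] Tan E x :=
  ∑ l, (J F D x (verBasis F x l : Tan E x)) ∘L (J F D x (verBasis F x l : Tan E x))

/-- The horizontal divergence of the torsion, `δ_𝓗 T (X) = ∑ (∇_{X_j} T)(X_j, X)` for an orthonormal
basis `X_j` of the horizontal space: the endomorphism of the tangent space at `x` with these values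
on an orthonormal basis. -/
def divTorsion (x : M) : Tan E x →L[ℝ] Tan E x :=
  ∑ a, (innerSL ℝ (tanBasis x a : Tan E x)).smulRight
    (∑ j, covTorsion F D (ext (horBasis F x j : Tan E x)) (ext (horBasis F x j : Tan E x))
      (ext (tanBasis x a)) x)

/-- The connection `∇^ε_X Y = ∇_X Y - T(X, Y) + (1/ε) J_Y X`. -/
def nablaEps (ε : ℝ) (X Y : Π x : M, Tan E x) : Π x : M, Tan E x := fun x ↦
  bott F D X Y x - bottTorsion F D X Y x + (1 / ε) • J F D x (Y x) (X x)

/-- The connection `∇̂^ε_X Y = ∇_X Y + (1/ε) J_X Y`. -/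
def adjointConn (ε : ℝ) (X Y : Π x : M, Tan E x) : Π x : M, Tan E x := fun x ↦
  bott F D X Y x + (1 / ε) • J F D x (X x) (Y x)

/-- `∇̂^ε` is the adjoint connection of `∇^ε`: `∇̂^ε_X Y = ∇^ε_X Y - T^ε(X, Y)`, where
`T^ε(X, Y) = ∇^ε_X Y - ∇^ε_Y X - [X, Y]` is the torsion of `∇^ε`. -/
theorem adjointConn_eq (ε : ℝ) (X Y : Π x : M, Tan E x) :
    adjointConn F D ε X Y = nablaEps F D ε X Y -
      (nablaEps F D ε X Y - nablaEps F D ε Y X - mlieBracket 𝓘(ℝ, E) X Y) := by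
  funext x
  have h : mlieBracket 𝓘(ℝ, E) Y X x = - mlieBracket 𝓘(ℝ, E) X Y x :=
    mlieBracket_swap_apply
  simp only [adjointConn, nablaEps, bottTorsion, Pi.sub_apply, h]
  abel

/-- The curvature `R(X, Y) Z = ∇_X ∇_Y Z - ∇_Y ∇_X Z - ∇_{[X, Y]} Z` of a connection on the tangent
bundle, given as an operation `C X Y = ∇_X Y` on vector fields. -/
def curvature (C : (Π x : M, Tan E x) → (Π x : M, Tan E x) → Π x : M, Tan E x)
    (X Y Z : Π x : M, Tan E x) : Π x : M, Tan E x :=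
  C X (C Y Z) - C Y (C X Z) - C (mlieBracket 𝓘(ℝ, E) X Y) Z

/-- The horizontal Ricci curvature `Ric_𝓗(u, v) = ∑ ⟨R(X_i, u) v, X_i⟩` of a connection at `x`, for
an orthonormal basis `X_i` of the horizontal space: the horizontal trace of the curvature tensor. -/
def ricciH (C : (Π x : M, Tan E x) → (Π x : M, Tan E x) → Π x : M, Tan E x)
    (x : M) (u v : Tan E x) : ℝ :=
  ∑ i, inner ℝ
    (curvature C (ext (horBasis F x i : Tan E x)) (ext u) (ext v) x) (horBasis F x i : Tan E x)

/-- The horizontal Ricci curvature as a linear map on the cotangent space at `x`. It is determined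
by `⟨Ric η, ξ⟩ = Ric_𝓗(η♯, ξ♯)`; here it is written in an orthonormal basis. -/
def ricciOp (C : (Π x : M, Tan E x) → (Π x : M, Tan E x) → Π x : M, Tan E x) (x : M) :
    (Tan E x →L[ℝ] ℝ) →L[ℝ] (Tan E x →L[ℝ] ℝ) :=
  ∑ a, ∑ b, ricciH F C x (tanBasis x a) (tanBasis x b) •
    (ContinuousLinearMap.apply ℝ ℝ (tanBasis x a)).smulRight (innerSL ℝ (tanBasis x b))

/-- The isomorphism `♭ : T_x M → T*_x M` defined by the metric. -/
def flat (x : M) : Tan E x ≃L[ℝ] (Tan E x →L[ℝ] ℝ) :=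
  (InnerProductSpace.toDual ℝ (Tan E x)).toContinuousLinearEquiv

/-- The linear map `η ↦ (A η♯)♭` on the cotangent space corresponding to an endomorphism `A` of the
tangent space. -/
def onForms {x : M} (A : Tan E x →L[ℝ] Tan E x) :
    (Tan E x →L[ℝ] ℝ) →L[ℝ] (Tan E x →L[ℝ] ℝ) :=
  (flat x).toContinuousLinearMap ∘L A ∘L (flat x).symm.toContinuousLinearMap

/-- The adjoint of an endomorphism of the tangent space at `x` with respect to the metric. -/
def metricAdjoint {x : M} (A : Tan E x →L[ℝ] Tan E x) : Tan E x →L[ℝ] Tan E x :=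
  haveI : CompleteSpace (Tan E x) := FiniteDimensional.complete ℝ _
  ContinuousLinearMap.adjoint A

/-- The potential `Ric_𝓗 - (1/ε) δ_𝓗 T + (1/ε) 𝐉²` of the Weitzenböck formula `d L f = □_ε df` for
the horizontal Laplacian `L`, as a linear map on the cotangent space: minus the zero-order term in
`□_ε = ∑ (∇^ε_{X_i} ∇^ε_{X_i} - ∇^ε_{∇_{X_i} X_i}) - (1/ε) 𝐉² + (1/ε) δ_𝓗 T - Ric_𝓗`. -/
def weitzenbockPotential (ε : ℝ) (x : M) :
    (Tan E x →L[ℝ] ℝ) →L[ℝ] (Tan E x →L[ℝ] ℝ) :=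
  ricciOp F (bott F D) x - (1 / ε) • onForms (divTorsion F D x) + (1 / ε) • onForms (JSq F D x)

end

end RiemannianFoliation

end

/-!
Let `D` be the Levi-Civita connection and `∇` the Bott connection, and write `u = u_𝓗 + u_𝓥` for the
decomposition of a tangent vector. Two facts describe `D` on a foliated manifold. As the leaves are
totally geodesic, the derivative of a horizontal field along a leaf is horizontal
(`IsTotallyGeodesic.ver_cov_hor`). As the metric is bundle-like, for a vertical field `Z` the
form `(X, Y) ↦ ⟨D_X Z, Y⟩` on horizontal vectors is skew-symmetric
(`IsLeviCivita.inner_cov_ver_skew`): in a foliation chart `π` one has `⟨X, Y⟩ = h(dπ X, dπ Y)`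
for horizontal `X`, `Y`, and this is differentiated in the direction `Z`, using
`Z (dπ X) = dπ [Z, X]`.

It follows that `⟨Z, T(X, Y)⟩ = 2 ⟨D_{X_𝓗} Z_𝓥, Y_𝓗⟩`, so that `T` is a tensor with vertical values,
that `J_Z X = 2 (D_{X_𝓗} Z_𝓥)_𝓗`, and that `∇_X = (D_X)^𝓗 ⊕ (D_X)^𝓥 - ½ J_X`, where the first two
terms are the connections induced by `D` on `𝓗` and on `𝓥`. As `J_X` is skew-symmetric, `∇` is a
metric connection (`mvfderiv_inner_eq_bott`); it preserves `𝓗` and `𝓥`.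

As `⟨J_X Z, W⟩ = ⟨X, T(Z, W)⟩`, the curvature of `∇̂^ε = ∇ + (1/ε) J` satisfies
(`inner_curvature_adjointConn`)

`⟨R̂(X, Y) Z, W⟩ = ⟨R(X, Y) Z, W⟩ + (1/ε²) ⟨[J_X, J_Y] Z, W⟩`
`  + (1/ε) (⟨T(X, Y), T(Z, W)⟩ + ⟨Y, (∇_X T)(Z, W)⟩ - ⟨X, (∇_Y T)(Z, W)⟩)`.

For `X = W = X_i` horizontal, `J_{X_i} = 0` removes the quadratic term, and `∇_Y T` is orthogonal to
`X_i`. Summing over `i` gives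
`Ric^ε(u, v) = Ric(u, v) - (1/ε) ⟨u, δT v⟩ + (1/ε) ⟨𝐉² u, v⟩` (`ricciH_adjointConn`), because
`⟨𝐉² u, v⟩ = - ∑ ⟨T(u, X_i), T(v, X_i)⟩`. This is the first assertion. The second one follows since
`𝐉²` is symmetric and so is `Ric` (`ricciH_bott_comm`): the horizontal part of the first Bianchi
identity for `∇` has no torsion terms, and `R(u, v)` is skew-symmetric.
-/

namespace RiemannianFoliation

/-! ### Locally smooth vector fields -/

section Smooth

variable {E : Type*} [NormedAddCommGroup E] [NormedSpace ℝ E]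
  {M : Type*} [TopologicalSpace M] [ChartedSpace E M] [IsManifold 𝓘(ℝ, E) ∞ M]
  {X Y Z : Π y : M, TangentSpace 𝓘(ℝ, E) y} {x : M}

/-- The vector field `X` is smooth in a neighbourhood of `x`. (Smoothness at the single point `x`
would only give, for each finite `k`, a neighbourhood on which `X` is of class `C^k`.) -/
def SmoothNear (X : Π y : M, TangentSpace 𝓘(ℝ, E) y) (x : M) : Prop :=
  ∀ᶠ y in 𝓝 x, CMDiffAt ∞ (T% X) y

lemma SmoothNear.eventually (hX : SmoothNear X x) : ∀ᶠ y in 𝓝 x, SmoothNear X y :=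
  eventually_eventually_nhds.2 hX

lemma SmoothNear.contMDiffAt (hX : SmoothNear X x) : CMDiffAt ∞ (T% X) x :=
  hX.self_of_nhds

lemma SmoothNear.mdifferentiableAt (hX : SmoothNear X x) : MDiffAt (T% X) x :=
  hX.contMDiffAt.mdifferentiableAt (by simp)

lemma SmoothNear.congr (hX : SmoothNear X x) (h : ∀ᶠ y in 𝓝 x, Y y = X y) : SmoothNear Y x := by
  filter_upwards [hX, eventually_eventually_nhds.2 h] with y hy hy'
  refine hy.congr_of_eventuallyEq ?_
  filter_upwards [hy'] with z hz
  simp [hz]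

lemma SmoothNear.exists_isOpen (hX : SmoothNear X x) :
    ∃ U : Set M, IsOpen U ∧ x ∈ U ∧ CMDiff[U] ∞ (T% X) := by
  obtain ⟨U, hU, ho, hx⟩ := eventually_nhds_iff.1 hX
  exact ⟨U, ho, hx, fun y hy ↦ (hU y hy).contMDiffWithinAt⟩

lemma smoothNear_of_contMDiffOn {U : Set M} (hU : IsOpen U) (hx : x ∈ U)
    (h : CMDiff[U] ∞ (T% X)) : SmoothNear X x := by
  filter_upwards [hU.mem_nhds hx] with y hy
  exact (h y hy).contMDiffAt (hU.mem_nhds hy)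

lemma SmoothNear.add (hX : SmoothNear X x) (hY : SmoothNear Y x) : SmoothNear (X + Y) x := by
  filter_upwards [hX, hY] with y h h'
  exact h.add_section h'

lemma SmoothNear.sub (hX : SmoothNear X x) (hY : SmoothNear Y x) : SmoothNear (X - Y) x := by
  filter_upwards [hX, hY] with y h h'
  exact h.sub_section h'

lemma SmoothNear.const_smul (a : ℝ) (hX : SmoothNear X x) : SmoothNear (a • X) x := by
  filter_upwards [hX] with y h
  exact h.const_smul_section

variable [FiniteDimensional ℝ E]

lemma SmoothNear.mlieBracket (hX : SmoothNear X x) (hY : SmoothNear Y x) :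
    SmoothNear (mlieBracket 𝓘(ℝ, E) X Y) x := by
  filter_upwards [hX, hY] with y h h'
  have : IsManifold 𝓘(ℝ, E) (((⊤ : ℕ∞) : ℕ∞ω) + 1) M := by simpa using ‹IsManifold 𝓘(ℝ, E) ∞ M›
  have : IsManifold 𝓘(ℝ, E) (minSmoothness ℝ 2) M := by
    simpa using inferInstanceAs (IsManifold 𝓘(ℝ, E) 2 M)
  exact ContMDiffAt.mlieBracket_vectorField (n := ⊤) h h' (by simp)

omit [FiniteDimensional ℝ E] in
lemma smoothNear_ext (v : Tan E x) :
    SmoothNear (FiberBundle.extend E (E := fun y : M ↦ TangentSpace 𝓘(ℝ, E) y) v) x := by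
  obtain ⟨s, hs, h⟩ := FiberBundle.exists_contMDiffOn_extend (k := ∞) 𝓘(ℝ, E) E
    (V := fun y : M ↦ TangentSpace 𝓘(ℝ, E) y) v
  filter_upwards [eventually_mem_nhds_iff.2 hs] with y hy
  exact (h y (mem_of_mem_nhds hy)).contMDiffAt hy

end Smooth

section Derivation

variable {E : Type*} [NormedAddCommGroup E] [NormedSpace ℝ E] [FiniteDimensional ℝ E]
  {G : Type*} [NormedAddCommGroup G] [NormedSpace ℝ G]
  {M : Type*} [TopologicalSpace M] [ChartedSpace E M] [IsManifold 𝓘(ℝ, E) ∞ M]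
  {X Y : Π y : M, TangentSpace 𝓘(ℝ, E) y} {x : M}

omit [FiniteDimensional ℝ E] in
/-- The derivative of a smooth function along a smooth vector field is smooth. -/
lemma contMDiffAt_mvfderiv_apply {f : M → G} (hf : ∀ᶠ y in 𝓝 x, CMDiffAt ∞ f y)
    (hX : CMDiffAt ∞ (T% X) x) : CMDiffAt ∞ (fun y ↦ mvfderiv 𝓘(ℝ, E) f y (X y)) x := by
  obtain ⟨U, hU, ho, hx⟩ := eventually_nhds_iff.1 hf
  have hfU : CMDiff[U] ∞ f := fun y hy ↦ (hU y hy).contMDiffWithinAt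
  have h1 := hfU.contMDiffOn_tangentMapWithin (m := ∞) (by simp) ho.uniqueMDiffOn
  have h2 := ((h1 ⟨x, X x⟩ hx).contMDiffAt
    ((FiberBundle.continuous_proj E (TangentSpace 𝓘(ℝ, E))).continuousAt.preimage_mem_nhds
      (ho.mem_nhds hx))).comp x hX
  have h3 := (contMDiff_snd_tangentBundle_modelSpace G 𝓘(ℝ, G) (n := ∞)).contMDiffAt.comp x h2
  refine h3.congr_of_eventuallyEq ?_
  filter_upwards [ho.mem_nhds hx] with y hy
  simp only [Function.comp, tangentMapWithin, mfderivWithin_of_isOpen ho hy]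
  rfl

/-- The commutator of the derivations defined by two vector fields is the derivation defined by
their Lie bracket, also for functions with values in a normed space. This is the corresponding
identity in a vector space, read in the chart at `x`. -/
lemma mvfderiv_mlieBracket {f : M → G} (hf : ∀ᶠ y in 𝓝 x, CMDiffAt ∞ f y)
    (hX : SmoothNear X x) (hY : SmoothNear Y x) :
    mvfderiv 𝓘(ℝ, E) f x (mlieBracket 𝓘(ℝ, E) X Y x) =
      mvfderiv 𝓘(ℝ, E) (fun y ↦ mvfderiv 𝓘(ℝ, E) f y (Y y)) x (X x) -
      mvfderiv 𝓘(ℝ, E) (fun y ↦ mvfderiv 𝓘(ℝ, E) f y (X y)) x (Y x) := by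
  set φ := extChartAt 𝓘(ℝ, E) x with hφ
  -- the function read in the chart at `x`
  set f' : E → G := f ∘ φ.symm with hf'
  have hφx : φ.symm (φ x) = x := extChartAt_to_inv x
  have hsrc : φ.source ∈ 𝓝 x := extChartAt_source_mem_nhds x
  have hcf : ContDiffAt ℝ ∞ f' (φ x) := by
    rw [← contMDiffAt_iff_contDiffAt]
    have h1 : CMDiffAt ∞ φ.symm (φ x) :=
      (contMDiffOn_extChartAt_symm x).contMDiffAt (extChartAt_target_mem_nhds x)
    exact ContMDiffAt.comp (φ x) (by rw [hφx]; exact hf.self_of_nhds) h1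
  -- the derivative of `f` along a vector given by its coordinates `v`
  have base : ∀ y ∈ φ.source, CMDiffAt ∞ f y → ∀ v : E,
      mvfderiv 𝓘(ℝ, E) f y ((mfderiv 𝓘(ℝ, E) 𝓘(ℝ, E) φ y).inverse v) =
        fderiv ℝ f' (φ y) v := by
    intro y hy hfy v
    have hinv := isInvertible_mfderiv_extChartAt (I := 𝓘(ℝ, E)) hy
    have hd' : MDifferentiableAt 𝓘(ℝ, E) 𝓘(ℝ, G) f' (φ y) := by
      have h1 : CMDiffAt ∞ φ.symm (φ y) :=
        (contMDiffOn_extChartAt_symm x).contMDiffAt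
          (extChartAt_target_mem_nhds' (φ.map_source hy))
      refine (ContMDiffAt.comp (φ y) ?_ h1).mdifferentiableAt (n := ∞) (by simp)
      rw [φ.left_inv hy]; exact hfy
    have hcongr : f =ᶠ[𝓝 y] f' ∘ φ := by
      filter_upwards [extChartAt_source_mem_nhds' hy] with z hz
      exact congrArg f ((extChartAt 𝓘(ℝ, E) x).left_inv hz).symm
    have hd : MDifferentiableAt 𝓘(ℝ, E) 𝓘(ℝ, E) φ y :=
      mdifferentiableAt_extChartAt (by simpa [φ] using hy)
    have : mfderiv 𝓘(ℝ, E) 𝓘(ℝ, G) f y =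
        (mfderiv 𝓘(ℝ, E) 𝓘(ℝ, G) f' (φ y)).comp (mfderiv 𝓘(ℝ, E) 𝓘(ℝ, E) φ y) := by
      rw [hcongr.mfderiv_eq, mfderiv_comp y hd' hd]
    have h2 : mfderiv 𝓘(ℝ, E) 𝓘(ℝ, G) f y ((mfderiv 𝓘(ℝ, E) 𝓘(ℝ, E) φ y).inverse v) =
        mfderiv 𝓘(ℝ, E) 𝓘(ℝ, G) f' (φ y) v := by
      rw [this]
      exact congrArg (mfderiv 𝓘(ℝ, E) 𝓘(ℝ, G) f' (φ y)) (hinv.self_apply_inverse v)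
    rw [mfderiv_eq_fderiv] at h2
    exact h2
  have key : ∀ Z : Π y : M, TangentSpace 𝓘(ℝ, E) y, ∀ᶠ y in 𝓝 x,
      mvfderiv 𝓘(ℝ, E) f y (Z y) = fderiv ℝ f' (φ y)
        (mpullbackWithin 𝓘(ℝ, E) 𝓘(ℝ, E) φ.symm Z (Set.range 𝓘(ℝ, E)) (φ y)) := by
    intro Z
    have h1 := eventuallyEq_mpullback_mpullbackWithin_extChartAt (s := Set.univ) (x := x)
      (I := 𝓘(ℝ, E)) Z
    rw [nhdsWithin_univ] at h1
    filter_upwards [h1, hf, hsrc] with y h1 h2 h3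
    exact (congrArg (mvfderiv 𝓘(ℝ, E) f y) h1).trans (base y h3 h2 _)
  have hdiff : ∀ Z : Π y : M, TangentSpace 𝓘(ℝ, E) y, SmoothNear Z x → DifferentiableAt ℝ
      (mpullbackWithin 𝓘(ℝ, E) 𝓘(ℝ, E) φ.symm Z (Set.range 𝓘(ℝ, E)) : E → E) (φ x) := by
    intro Z hZ
    have := MDifferentiableWithinAt.differentiableWithinAt_mpullbackWithin_vectorField
      (s := Set.univ) (hZ.mdifferentiableAt.mdifferentiableWithinAt)
    exact this.differentiableAt (by simp)
  -- the iterated derivative `W (Z f)` is computed in the chart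
  have hcomp : ∀ W Z : Π y : M, TangentSpace 𝓘(ℝ, E) y, SmoothNear W x → SmoothNear Z x →
      mvfderiv 𝓘(ℝ, E) (fun y ↦ mvfderiv 𝓘(ℝ, E) f y (Z y)) x (W x) =
      fderiv ℝ (fun u ↦ fderiv ℝ f' u
        (mpullbackWithin 𝓘(ℝ, E) 𝓘(ℝ, E) φ.symm Z (Set.range 𝓘(ℝ, E)) u)) (φ x)
        (mpullbackWithin 𝓘(ℝ, E) 𝓘(ℝ, E) φ.symm W (Set.range 𝓘(ℝ, E)) (φ x)) := by
    intro W Z hW hZ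
    set g : E → G := fun u ↦ fderiv ℝ f' u
        (mpullbackWithin 𝓘(ℝ, E) 𝓘(ℝ, E) φ.symm Z (Set.range 𝓘(ℝ, E)) u) with hg
    have hgd : DifferentiableAt ℝ g (φ x) :=
      ((hcf.fderiv_right (m := 1) (by norm_num; exact ENat.LEInfty.out)).differentiableAt
        one_ne_zero).clm_apply (hdiff Z hZ)
    have hd : MDifferentiableAt 𝓘(ℝ, E) 𝓘(ℝ, E) φ x :=
      mdifferentiableAt_extChartAt (by simp)
    have hcongr : (fun y ↦ mvfderiv 𝓘(ℝ, E) f y (Z y)) =ᶠ[𝓝 x] g ∘ φ := key Z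
    have h1 := eventuallyEq_mpullback_mpullbackWithin_extChartAt (s := Set.univ) (x := x)
      (I := 𝓘(ℝ, E)) W
    rw [nhdsWithin_univ] at h1
    have hinv := isInvertible_mfderiv_extChartAt (I := 𝓘(ℝ, E)) (mem_extChartAt_source x)
    have h2 : mfderiv 𝓘(ℝ, E) 𝓘(ℝ, E) φ x (W x) =
        mpullbackWithin 𝓘(ℝ, E) 𝓘(ℝ, E) φ.symm W (Set.range 𝓘(ℝ, E)) (φ x) := by
      rw [h1.self_of_nhds]
      exact hinv.self_apply_inverse _
    have h3 : mfderiv 𝓘(ℝ, E) 𝓘(ℝ, G) (fun y ↦ mvfderiv 𝓘(ℝ, E) f y (Z y)) x =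
        (mfderiv 𝓘(ℝ, E) 𝓘(ℝ, G) g (φ x)).comp (mfderiv 𝓘(ℝ, E) 𝓘(ℝ, E) φ x) := by
      rw [hcongr.mfderiv_eq, mfderiv_comp x hgd.mdifferentiableAt hd]
    have h4 : mfderiv 𝓘(ℝ, E) 𝓘(ℝ, G) (fun y ↦ mvfderiv 𝓘(ℝ, E) f y (Z y)) x (W x) =
        mfderiv 𝓘(ℝ, E) 𝓘(ℝ, G) g (φ x)
          (mpullbackWithin 𝓘(ℝ, E) 𝓘(ℝ, E) φ.symm W (Set.range 𝓘(ℝ, E)) (φ x)) := by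
      rw [h3, ← h2]; rfl
    rw [mfderiv_eq_fderiv] at h4
    exact h4
  rw [hcomp X Y hX hY, hcomp Y X hY hX,
    ← fderiv_apply_lieBracket hcf
      (by rw [minSmoothness_of_isRCLikeNormedField]; exact ENat.LEInfty.out)
      (hdiff Y hY) (hdiff X hX),
    ← base x (mem_extChartAt_source x) hf.self_of_nhds, ← mlieBracketWithin_univ,
    mlieBracketWithin_apply]
  have huniv : φ.symm ⁻¹' Set.univ ∩ Set.range 𝓘(ℝ, E) = Set.univ := by simp
  rw [huniv]
  exact congrArg (fun u : E ↦ mvfderiv 𝓘(ℝ, E) f x ((mfderiv 𝓘(ℝ, E) 𝓘(ℝ, E) φ x).inverse u))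
    (congrFun lieBracketWithin_univ (φ x))

end Derivation

/-! ### The horizontal and vertical projections -/

section Metric

variable {E : Type*} [NormedAddCommGroup E] [NormedSpace ℝ E] [FiniteDimensional ℝ E]
  {M : Type*} [TopologicalSpace M] [ChartedSpace E M] [IsManifold 𝓘(ℝ, E) ∞ M]
  [RiemannianBundle (fun x : M ↦ TangentSpace 𝓘(ℝ, E) x)]
  [IsContMDiffRiemannianBundle 𝓘(ℝ, E) ∞ E (fun x : M ↦ TangentSpace 𝓘(ℝ, E) x)]
  {X Y Z : Π y : M, TangentSpace 𝓘(ℝ, E) y} {x : M}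

omit [FiniteDimensional ℝ E] in
lemma SmoothNear.inner (hX : SmoothNear X x) (hY : SmoothNear Y x) :
    ∀ᶠ y in 𝓝 x, CMDiffAt ∞ (fun y ↦ (inner ℝ (X y) (Y y) : ℝ)) y := by
  filter_upwards [hX, hY] with y h h'
  exact ContMDiffAt.inner_bundle (E := fun x : M ↦ TangentSpace 𝓘(ℝ, E) x) (b := id) h h'

/-- A vector field is smooth at `x` if its inner products with smooth vector fields are: its
coefficients in a local frame are obtained from these inner products by the inverse of the Gram
matrix of the frame. -/
lemma contMDiffAt_of_inner
    (h : ∀ W : Π y : M, TangentSpace 𝓘(ℝ, E) y, SmoothNear W x →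
      CMDiffAt ∞ (fun y ↦ (inner ℝ (X y) (W y) : ℝ)) x) :
    CMDiffAt ∞ (T% X) x := by
  set e := trivializationAt E (fun x : M ↦ TangentSpace 𝓘(ℝ, E) x) x with he
  set b := Module.finBasis ℝ E
  have hs := e.isLocalFrameOn_localFrame_baseSet 𝓘(ℝ, E) ∞ b
  set s := e.localFrame b with hsdef
  have hx : x ∈ e.baseSet := FiberBundle.mem_baseSet_trivializationAt' x
  have hsx : ∀ i, SmoothNear (s i) x := fun i ↦
    smoothNear_of_contMDiffOn e.open_baseSet hx (hs.contMDiffOn i)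
  let ι := Fin (Module.finrank ℝ E)
  -- `c` are the coefficients of `X` in the frame `s`, and `G` is the Gram matrix of `s`
  let c : M → ι → ℝ := fun y i ↦ hs.coeff i y (X y)
  let G : M → (ι → ℝ) →L[ℝ] (ι → ℝ) := fun y ↦ ∑ i, ∑ j, (inner ℝ (s i y) (s j y) : ℝ) •
    (ContinuousLinearMap.proj (R := ℝ) (φ := fun _ : ι ↦ ℝ) i).smulRight (Pi.single j (1 : ℝ))
  have hG : ∀ y v j, G y v j = inner ℝ (∑ i, v i • s i y) (s j y) := by
    intro y v j
    simp [G, sum_inner, Finset.sum_apply, Pi.single_apply, inner_smul_left, mul_comm]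
    rfl
  have hGc : ∀ y ∈ e.baseSet, G y (c y) = fun j ↦ (inner ℝ (X y) (s j y) : ℝ) := by
    intro y hy
    ext j
    rw [hG, ← hs.coeff_sum_eq X hy]
  have hGinj : ∀ y ∈ e.baseSet, Function.Injective (G y) := by
    intro y hy
    rw [injective_iff_map_eq_zero]
    intro v hv
    have h0 : ∑ i, v i • s i y = 0 := by
      rw [← inner_self_eq_zero (𝕜 := ℝ)]
      conv_lhs => rw [inner_sum]
      refine Finset.sum_eq_zero fun j _ ↦ ?_
      rw [inner_smul_right, ← hG, hv]
      simp
    ext i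
    exact Fintype.linearIndependent_iff.1 (hs.linearIndependent hy) v h0 i
  have hGinv : ∀ y ∈ e.baseSet, (G y).IsInvertible := by
    intro y hy
    exact ⟨(LinearEquiv.ofInjectiveEndo (G y : (ι → ℝ) →ₗ[ℝ] (ι → ℝ))
      (hGinj y hy)).toContinuousLinearEquiv, by ext; rfl⟩
  have hGs : ContMDiffAt 𝓘(ℝ, E) 𝓘(ℝ, (ι → ℝ) →L[ℝ] (ι → ℝ)) ∞ G x := by
    refine contMDiffAt_finsetSum fun i _ ↦ contMDiffAt_finsetSum fun j _ ↦ ?_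
    exact ((hsx i).inner (hsx j)).self_of_nhds.smul contMDiffAt_const
  have hαs : ContMDiffAt 𝓘(ℝ, E) 𝓘(ℝ, ι → ℝ) ∞ (fun y j ↦ (inner ℝ (X y) (s j y) : ℝ)) x := by
    exact contMDiffAt_pi_space.2 fun j ↦ h _ (hsx j)
  have hcs : ContMDiffAt 𝓘(ℝ, E) 𝓘(ℝ, ι → ℝ) ∞ c x := by
    obtain ⟨A, hA⟩ := hGinv x hx
    have h1 : ContMDiffAt 𝓘(ℝ, E) 𝓘(ℝ, (ι → ℝ) →L[ℝ] (ι → ℝ)) ∞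
        (fun y ↦ (G y).inverse) x := by
      have := contDiffAt_map_inverse (n := ∞) A
      rw [hA] at this
      exact this.contMDiffAt.comp x hGs
    refine (h1.clm_apply hαs).congr_of_eventuallyEq ?_
    filter_upwards [e.open_baseSet.mem_nhds hx] with y hy
    rw [← hGc y hy, (hGinv y hy).inverse_apply_self]
  refine hs.contMDiffAt_of_coeff (fun i ↦ ?_) (e.open_baseSet.mem_nhds hx)
  exact contMDiffAt_pi_space.1 hcs i

end Metric

section Projections

variable {n : ℕ} {E : Type*} [NormedAddCommGroup E] [NormedSpace ℝ E] [FiniteDimensional ℝ E]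
  {M : Type*} [TopologicalSpace M] [ChartedSpace E M]
  {F : Foliation n E M} {x : M}

omit [FiniteDimensional ℝ E] in
/-- The submersions defining the foliation have the same kernel. -/
lemma Foliation.mem_vertical_iff {c : Set M × (M → EuclideanSpace ℝ (Fin n))} (hc : c ∈ F.charts)
    (hx : x ∈ c.1) {v : Tan E x} :
    v ∈ F.vertical x ↔ mvfderiv 𝓘(ℝ, E) c.2 x v = 0 := by
  have key : ∀ c ∈ F.charts, ∀ c' ∈ F.charts, x ∈ c.1 → x ∈ c'.1 →
      mvfderiv 𝓘(ℝ, E) c'.2 x v = 0 → mvfderiv 𝓘(ℝ, E) c.2 x v = 0 := by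
    intro c hc c' hc' hx hx' h
    obtain ⟨ψ, hψ, hψ'⟩ := F.transition c hc c' hc' x ⟨hx, hx'⟩
    have h1 : MDifferentiableAt (𝓡 n) (𝓡 n) ψ (c'.2 x) :=
      hψ.contMDiffAt.mdifferentiableAt (by simp)
    have h2 : MDifferentiableAt 𝓘(ℝ, E) (𝓡 n) c'.2 x :=
      ((F.smooth c' hc' x hx').contMDiffAt ((F.isOpen c' hc').mem_nhds hx')).mdifferentiableAt
        (by simp)
    have h3 : c.2 =ᶠ[𝓝 x] ψ ∘ c'.2 := hψ'
    have h4 : mfderiv 𝓘(ℝ, E) (𝓡 n) c.2 x =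
        (mfderiv (𝓡 n) (𝓡 n) ψ (c'.2 x)).comp (mfderiv 𝓘(ℝ, E) (𝓡 n) c'.2 x) := by
      rw [h3.mfderiv_eq, mfderiv_comp x h1 h2]
    have h5 : mfderiv 𝓘(ℝ, E) (𝓡 n) c'.2 x v = 0 := h
    have h6 : mfderiv 𝓘(ℝ, E) (𝓡 n) c.2 x v = 0 := by
      rw [h4]
      exact (congrArg (mfderiv (𝓡 n) (𝓡 n) ψ (c'.2 x)) h5).trans (map_zero _)
    exact h6
  simp only [Foliation.vertical, Submodule.mem_iInf]
  constructor
  · intro h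
    exact h c hc hx
  · intro h c' hc' hx'
    exact key c' hc' c hc hx' hx h

variable [RiemannianBundle (fun x : M ↦ TangentSpace 𝓘(ℝ, E) x)]

variable (F) in
lemma Foliation.hor_add_ver (v : Tan E x) : F.hor x v + F.ver x v = v := by
  rw [add_comm]
  exact Submodule.starProjection_add_starProjection_orthogonal (K := F.vertical x) v

lemma Foliation.ver_mem (v : Tan E x) : F.ver x v ∈ F.vertical x :=
  Submodule.starProjection_apply_mem _ _

lemma Foliation.hor_mem (v : Tan E x) : F.hor x v ∈ F.horizontal x :=
  Submodule.starProjection_apply_mem _ _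

lemma Foliation.hor_eq_self {v : Tan E x} (hv : v ∈ F.horizontal x) : F.hor x v = v :=
  Submodule.starProjection_eq_self_iff.2 hv

lemma Foliation.ver_eq_self {v : Tan E x} (hv : v ∈ F.vertical x) : F.ver x v = v :=
  Submodule.starProjection_eq_self_iff.2 hv

lemma Foliation.hor_eq_zero {v : Tan E x} (hv : v ∈ F.vertical x) : F.hor x v = 0 := by
  have := F.hor_add_ver v
  rwa [F.ver_eq_self hv, add_eq_right] at this

lemma Foliation.ver_eq_zero {v : Tan E x} (hv : v ∈ F.horizontal x) : F.ver x v = 0 := by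
  have := F.hor_add_ver v
  rwa [F.hor_eq_self hv, add_eq_left] at this

@[simp]
lemma Foliation.hor_hor (v : Tan E x) : F.hor x (F.hor x v) = F.hor x v :=
  F.hor_eq_self (F.hor_mem v)

@[simp]
lemma Foliation.ver_ver (v : Tan E x) : F.ver x (F.ver x v) = F.ver x v :=
  F.ver_eq_self (F.ver_mem v)

@[simp]
lemma Foliation.hor_ver (v : Tan E x) : F.hor x (F.ver x v) = 0 :=
  F.hor_eq_zero (F.ver_mem v)

@[simp]
lemma Foliation.ver_hor (v : Tan E x) : F.ver x (F.hor x v) = 0 :=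
  F.ver_eq_zero (F.hor_mem v)

variable (F) in
lemma Foliation.inner_hor_left (u v : Tan E x) :
    (inner ℝ (F.hor x u) v : ℝ) = inner ℝ u (F.hor x v) :=
  Submodule.inner_starProjection_left_eq_right _ u v

variable (F) in
lemma Foliation.inner_ver_left (u v : Tan E x) :
    (inner ℝ (F.ver x u) v : ℝ) = inner ℝ u (F.ver x v) :=
  Submodule.inner_starProjection_left_eq_right _ u v

omit [FiniteDimensional ℝ E] in
lemma Foliation.inner_eq_zero {u v : Tan E x} (hu : u ∈ F.vertical x) (hv : v ∈ F.horizontal x) :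
    (inner ℝ u v : ℝ) = 0 :=
  Submodule.inner_right_of_mem_orthogonal hu hv

/-- For a bundle-like metric, the inner product of the horizontal parts of two tangent vectors is
determined by their images in the base. -/
lemma Foliation.IsBundleLike.exists_metric (hF : F.IsBundleLike)
    {c : Set M × (M → EuclideanSpace ℝ (Fin n))} (hc : c ∈ F.charts) :
    ∃ h : EuclideanSpace ℝ (Fin n) →
        EuclideanSpace ℝ (Fin n) →L[ℝ] EuclideanSpace ℝ (Fin n) →L[ℝ] ℝ,
      ContDiffOn ℝ ∞ h (c.2 '' c.1) ∧ ∀ y ∈ c.1, ∀ u v : Tan E y,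
        (inner ℝ (F.hor y u) v : ℝ) =
          h (c.2 y) (mvfderiv 𝓘(ℝ, E) c.2 y u) (mvfderiv 𝓘(ℝ, E) c.2 y v) := by
  obtain ⟨h, hs, -, hh⟩ := hF c hc
  refine ⟨h, hs, fun y hy u v ↦ ?_⟩
  have key : ∀ w : Tan E y, mvfderiv 𝓘(ℝ, E) c.2 y (F.hor y w) = mvfderiv 𝓘(ℝ, E) c.2 y w := by
    intro w
    conv_rhs => rw [← F.hor_add_ver w, map_add, (F.mem_vertical_iff hc hy).1 (F.ver_mem w),
      add_zero]
  rw [← F.hor_hor u, F.inner_hor_left, ← hh y hy _ (F.hor_mem u) _ (F.hor_mem v), ← key u, ← key v]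
  rfl

end Projections

section SmoothProjections

variable {n : ℕ} {E : Type*} [NormedAddCommGroup E] [NormedSpace ℝ E] [FiniteDimensional ℝ E]
  {M : Type*} [TopologicalSpace M] [ChartedSpace E M] [IsManifold 𝓘(ℝ, E) ∞ M]
  [RiemannianBundle (fun x : M ↦ TangentSpace 𝓘(ℝ, E) x)]
  [IsContMDiffRiemannianBundle 𝓘(ℝ, E) ∞ E (fun x : M ↦ TangentSpace 𝓘(ℝ, E) x)]
  {F : Foliation n E M} {X Y Z : Π y : M, TangentSpace 𝓘(ℝ, E) y} {x : M}

omit [FiniteDimensional ℝ E] [RiemannianBundle (fun x : M ↦ TangentSpace 𝓘(ℝ, E) x)]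
  [IsContMDiffRiemannianBundle 𝓘(ℝ, E) ∞ E (fun x : M ↦ TangentSpace 𝓘(ℝ, E) x)]
  [IsManifold 𝓘(ℝ, E) ∞ M] in
lemma Foliation.eventually_contMDiffAt {c : Set M × (M → EuclideanSpace ℝ (Fin n))}
    (hc : c ∈ F.charts) (hx : x ∈ c.1) : ∀ᶠ y in 𝓝 x, CMDiffAt ∞ c.2 y := by
  filter_upwards [(F.isOpen c hc).mem_nhds hx] with y hy
  exact (F.smooth c hc y hy).contMDiffAt ((F.isOpen c hc).mem_nhds hy)

/-- The horizontal projection of a smooth vector field is smooth. -/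
lemma SmoothNear.hor (hF : F.IsBundleLike) (hX : SmoothNear X x) :
    SmoothNear (fun y ↦ F.hor y (X y)) x := by
  obtain ⟨c, hc, hxc⟩ := F.cover x
  obtain ⟨h, hs, hh⟩ := hF.exists_metric hc
  filter_upwards [hX, (F.isOpen c hc).mem_nhds hxc] with y hXy hy
  refine contMDiffAt_of_inner fun W hW ↦ ?_
  have hπ := F.eventually_contMDiffAt hc hy
  have h1 : CMDiffAt ∞ (h ∘ c.2) y := by
    refine ContMDiffWithinAt.contMDiffAt (s := c.1) ?_ ((F.isOpen c hc).mem_nhds hy)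
    exact (hs (c.2 y) ⟨y, hy, rfl⟩).contMDiffWithinAt.comp y
      hπ.self_of_nhds.contMDiffWithinAt (Set.mapsTo_image _ _)
  have h2 := (h1.clm_apply (contMDiffAt_mvfderiv_apply hπ hXy)).clm_apply
    (contMDiffAt_mvfderiv_apply hπ hW.contMDiffAt)
  refine h2.congr_of_eventuallyEq ?_
  filter_upwards [(F.isOpen c hc).mem_nhds hy] with z hz
  exact hh z hz _ _

/-- The vertical projection of a smooth vector field is smooth. -/
lemma SmoothNear.ver (hF : F.IsBundleLike) (hX : SmoothNear X x) :
    SmoothNear (fun y ↦ F.ver y (X y)) x := by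
  refine (hX.sub (hX.hor hF)).congr (Filter.Eventually.of_forall fun y ↦ ?_)
  rw [Pi.sub_apply, eq_sub_iff_add_eq', F.hor_add_ver]

variable {D : CovariantDerivative 𝓘(ℝ, E) E (fun x : M ↦ TangentSpace 𝓘(ℝ, E) x)}

omit [IsContMDiffRiemannianBundle 𝓘(ℝ, E) ∞ E (fun x : M ↦ TangentSpace 𝓘(ℝ, E) x)] in
lemma SmoothNear.cov (hD : IsLeviCivita D) (hX : SmoothNear X x) (hY : SmoothNear Y x) :
    SmoothNear (fun y ↦ D Y y (X y)) x := by
  obtain ⟨U, ho, hx, hU⟩ := hY.exists_isOpen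
  have := hD.smooth U ho
  have h1 := this.contMDiff (σ := Y) (by simpa using hU)
  filter_upwards [hX, ho.mem_nhds hx] with y hXy hy
  have h2 := (h1 y hy).contMDiffAt (ho.mem_nhds hy)
  exact h2.clm_bundle_apply hXy

end SmoothProjections

/-! ### The Levi-Civita connection of a foliated manifold -/

section Calculus

variable {E : Type*} [NormedAddCommGroup E] [NormedSpace ℝ E]
  {G G' : Type*} [NormedAddCommGroup G] [NormedSpace ℝ G] [NormedAddCommGroup G']
  [NormedSpace ℝ G'] {M : Type*} [TopologicalSpace M] [ChartedSpace E M] {x : M}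

lemma mvfderiv_clm_apply {A : M → G →L[ℝ] G'} {a : M → G}
    (hA : MDifferentiableAt 𝓘(ℝ, E) 𝓘(ℝ, G →L[ℝ] G') A x)
    (ha : MDifferentiableAt 𝓘(ℝ, E) 𝓘(ℝ, G) a x) (v : TangentSpace 𝓘(ℝ, E) x) :
    mvfderiv 𝓘(ℝ, E) (fun y ↦ A y (a y)) x v =
      mvfderiv 𝓘(ℝ, E) A x v (a x) + A x (mvfderiv 𝓘(ℝ, E) a x v) := by
  have h := hA.clm_apply ha
  rw [h.mvfderiv, hA.mvfderiv, ha.mvfderiv]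
  have h1 := hA.differentiableWithinAt_writtenInExtChartAt
  have h2 := ha.differentiableWithinAt_writtenInExtChartAt
  have h3 := fderivWithin_clm_apply (by simp) h1 h2
  have hA' : writtenInExtChartAt 𝓘(ℝ, E) 𝓘(ℝ, G →L[ℝ] G') x A (extChartAt 𝓘(ℝ, E) x x) = A x :=
    congrArg A (extChartAt_to_inv x)
  have ha' : writtenInExtChartAt 𝓘(ℝ, E) 𝓘(ℝ, G) x a (extChartAt 𝓘(ℝ, E) x x) = a x :=
    congrArg a (extChartAt_to_inv x)
  rw [hA', ha'] at h3
  rw [add_comm]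
  exact congrArg (fun L : E →L[ℝ] G' ↦ L v) h3

lemma mvfderiv_congr {f g : M → G} (h : f =ᶠ[𝓝 x] g) :
    mvfderiv 𝓘(ℝ, E) f x = mvfderiv 𝓘(ℝ, E) g x := by
  have := h.mfderiv_eq (I := 𝓘(ℝ, E)) (I' := 𝓘(ℝ, G))
  ext v
  exact congrArg (fun L : E →L[ℝ] G ↦ L v) this

/-- A function of `f` has zero derivative along the kernel of the differential of `f`. The outer
function is only required to be differentiable within the image, which need not be open. -/
lemma mdifferentiableAt_comp_of_image {f : M → G} {h : G → G'} {U : Set M} (hU : U ∈ 𝓝 x)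
    (hh : DifferentiableWithinAt ℝ h (f '' U) (f x))
    (hf : MDifferentiableAt 𝓘(ℝ, E) 𝓘(ℝ, G) f x) :
    MDifferentiableAt 𝓘(ℝ, E) 𝓘(ℝ, G') (h ∘ f) x ∧
      ∀ v : TangentSpace 𝓘(ℝ, E) x, mvfderiv 𝓘(ℝ, E) f x v = 0 →
        mvfderiv 𝓘(ℝ, E) (h ∘ f) x v = 0 := by
  have h1 : HasMFDerivWithinAt 𝓘(ℝ, G) 𝓘(ℝ, G') h (f '' U) (f x)
      (fderivWithin ℝ h (f '' U) (f x)) := hh.hasFDerivWithinAt.hasMFDerivWithinAt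
  have h2 := (h1.comp x (hf.hasMFDerivAt.hasMFDerivWithinAt (s := U))
    (Set.subset_preimage_image _ _)).hasMFDerivAt hU
  refine ⟨h2.mdifferentiableAt, fun v hv ↦ ?_⟩
  have h3 : mfderiv 𝓘(ℝ, E) 𝓘(ℝ, G') (h ∘ f) x v = 0 := by
    rw [h2.mfderiv]
    exact (congrArg (fderivWithin ℝ h (f '' U) (f x)) hv).trans (map_zero _)
  exact h3

end Calculus

section LeviCivita

variable {n : ℕ} {E : Type*} [NormedAddCommGroup E] [NormedSpace ℝ E] [FiniteDimensional ℝ E]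
  {M : Type*} [TopologicalSpace M] [ChartedSpace E M] [IsManifold 𝓘(ℝ, E) ∞ M]
  [RiemannianBundle (fun x : M ↦ TangentSpace 𝓘(ℝ, E) x)]
  [IsContMDiffRiemannianBundle 𝓘(ℝ, E) ∞ E (fun x : M ↦ TangentSpace 𝓘(ℝ, E) x)]
  {F : Foliation n E M} {X Y Z : Π y : M, TangentSpace 𝓘(ℝ, E) y} {x : M}
  {D : CovariantDerivative 𝓘(ℝ, E) E (fun x : M ↦ TangentSpace 𝓘(ℝ, E) x)}

omit [IsContMDiffRiemannianBundle 𝓘(ℝ, E) ∞ E (fun x : M ↦ TangentSpace 𝓘(ℝ, E) x)] in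
lemma IsLeviCivita.mvfderiv_inner (hD : IsLeviCivita D) (hX : SmoothNear X x)
    (hY : SmoothNear Y x) (v : Tan E x) :
    mvfderiv 𝓘(ℝ, E) (fun y ↦ (inner ℝ (X y) (Y y) : ℝ)) x v =
      inner ℝ (D X x v) (Y x) + inner ℝ (X x) (D Y x v) :=
  hD.metric x X Y v hX.mdifferentiableAt hY.mdifferentiableAt

omit [IsContMDiffRiemannianBundle 𝓘(ℝ, E) ∞ E (fun x : M ↦ TangentSpace 𝓘(ℝ, E) x)] in
lemma IsLeviCivita.mlieBracket_eq (hD : IsLeviCivita D) (hX : SmoothNear X x)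
    (hY : SmoothNear Y x) :
    mlieBracket 𝓘(ℝ, E) X Y x = D Y x (X x) - D X x (Y x) :=
  (D.torsion_eq_zero_iff.1 hD.torsion hX.mdifferentiableAt hY.mdifferentiableAt).symm

/-- The components of `D` that mix the vertical and the horizontal bundle are adjoint to each other
up to sign, as these bundles are orthogonal. -/
lemma IsLeviCivita.inner_cov_ver_hor (hD : IsLeviCivita D) (hF : F.IsBundleLike)
    (hX : SmoothNear X x) (hY : SmoothNear Y x) (v : Tan E x) :
    (inner ℝ (D (fun y ↦ F.ver y (X y)) x v) (F.hor x (Y x)) : ℝ) =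
      - inner ℝ (F.ver x (X x)) (D (fun y ↦ F.hor y (Y y)) x v) := by
  have h := hD.mvfderiv_inner (hX.ver hF) (hY.hor hF) v
  have h0 : (fun y ↦ (inner ℝ (F.ver y (X y)) (F.hor y (Y y)) : ℝ)) = fun _ ↦ 0 := by
    funext y
    exact F.inner_eq_zero (F.ver_mem _) (F.hor_mem _)
  rw [h0, mvfderiv_const] at h
  simp only [zero_apply] at h
  linarith

/-- As the leaves are totally geodesic, the derivative of a vertical vector field along a vertical
vector is vertical. -/
lemma Foliation.IsTotallyGeodesic.cov_ver_mem (hF' : F.IsTotallyGeodesic D) (hF : F.IsBundleLike)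
    (hX : SmoothNear X x) {v : Tan E x} (hv : v ∈ F.vertical x) :
    D (fun y ↦ F.ver y (X y)) x v ∈ F.vertical x := by
  obtain ⟨U, hU, hxU, hXU⟩ := (hX.ver hF).exists_isOpen
  obtain ⟨U', hU', hxU', hvU⟩ := ((smoothNear_ext v).ver hF).exists_isOpen
  have := hF' (U ∩ U') _ _ (hU.inter hU') (hvU.mono Set.inter_subset_right)
    (hXU.mono Set.inter_subset_left) (fun y _ ↦ F.ver_mem _) (fun y _ ↦ F.ver_mem _) x ⟨hxU, hxU'⟩
  simpa [F.ver_eq_self hv] using this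

/-- As the leaves are totally geodesic, the derivative of a horizontal vector field along a
vertical vector is horizontal. -/
lemma Foliation.IsTotallyGeodesic.ver_cov_hor (hF' : F.IsTotallyGeodesic D) (hD : IsLeviCivita D)
    (hF : F.IsBundleLike) (hX : SmoothNear X x) {v : Tan E x} (hv : v ∈ F.vertical x) :
    F.ver x (D (fun y ↦ F.hor y (X y)) x v) = 0 := by
  refine ext_inner_left ℝ fun w ↦ ?_
  have h := hD.inner_cov_ver_hor hF (smoothNear_ext w) hX v
  rw [F.inner_eq_zero (hF'.cov_ver_mem hF (smoothNear_ext w) hv) (F.hor_mem _)] at h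
  rw [← F.inner_ver_left, inner_zero_right]
  simpa using h

set_option synthInstance.maxHeartbeats 200000 in
/-- For a bundle-like metric, a vertical vector field preserves the inner product of horizontal
vectors infinitesimally: this is obtained by differentiating, along the leaves, the formula for
the inner product of horizontal vector fields in terms of the metric of the base. -/
lemma IsLeviCivita.inner_cov_ver_skew (hD : IsLeviCivita D) (hF : F.IsBundleLike)
    (hX : SmoothNear X x) (hY : SmoothNear Y x) (hZ : SmoothNear Z x) :
    (inner ℝ (D (fun y ↦ F.ver y (Z y)) x (F.hor x (X x))) (F.hor x (Y x)) : ℝ) =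
      - inner ℝ (F.hor x (X x)) (D (fun y ↦ F.ver y (Z y)) x (F.hor x (Y x))) := by
  obtain ⟨c, hc, hxc⟩ := F.cover x
  obtain ⟨h, hs, hh⟩ := hF.exists_metric hc
  have hU := (F.isOpen c hc).mem_nhds hxc
  have hπ := F.eventually_contMDiffAt hc hxc
  set W : Π y : M, TangentSpace 𝓘(ℝ, E) y := fun y ↦ F.ver y (Z y) with hWdef
  have hW : SmoothNear W x := hZ.ver hF
  have hW0 : ∀ᶠ y in 𝓝 x, mvfderiv 𝓘(ℝ, E) c.2 y (W y) = 0 := by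
    filter_upwards [hU] with y hy
    exact (F.mem_vertical_iff hc hy).1 (F.ver_mem _)
  -- the metric of the base is constant along the leaves
  obtain ⟨hhd, hhW⟩ := mdifferentiableAt_comp_of_image hU
    ((hs.differentiableOn (by simp)) _ ⟨x, hxc, rfl⟩)
    (hπ.self_of_nhds.mdifferentiableAt (by simp))
  replace hhW := hhW _ hW0.self_of_nhds
  have hP : ∀ P : Π y : M, TangentSpace 𝓘(ℝ, E) y, SmoothNear P x →
      MDifferentiableAt 𝓘(ℝ, E) 𝓘(ℝ, EuclideanSpace ℝ (Fin n))
        (fun y ↦ mvfderiv 𝓘(ℝ, E) c.2 y (P y)) x := fun P hP ↦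
    (contMDiffAt_mvfderiv_apply hπ hP.contMDiffAt).mdifferentiableAt (by simp)
  -- the derivative of `dπ P` along the vertical field `W` is `dπ [W, P]`
  have hPW : ∀ P : Π y : M, TangentSpace 𝓘(ℝ, E) y, SmoothNear P x →
      mvfderiv 𝓘(ℝ, E) (fun y ↦ mvfderiv 𝓘(ℝ, E) c.2 y (P y)) x (W x) =
        mvfderiv 𝓘(ℝ, E) c.2 x (mlieBracket 𝓘(ℝ, E) W P x) := by
    intro P hP
    rw [mvfderiv_mlieBracket hπ hW hP, mvfderiv_congr (g := fun _ ↦ 0) hW0, mvfderiv_const]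
    simp
  have hXh := hX.hor hF
  have hYh := hY.hor hF
  set P : Π y : M, TangentSpace 𝓘(ℝ, E) y := fun y ↦ F.hor y (X y) with hPdef
  set Q : Π y : M, TangentSpace 𝓘(ℝ, E) y := fun y ↦ F.hor y (Y y) with hQdef
  have e1 := hD.mvfderiv_inner hXh hYh (W x)
  have e2 : (fun y ↦ (inner ℝ (P y) (Q y) : ℝ)) =ᶠ[𝓝 x] fun y ↦
      (h ∘ c.2) y (mvfderiv 𝓘(ℝ, E) c.2 y (P y)) (mvfderiv 𝓘(ℝ, E) c.2 y (Q y)) := by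
    filter_upwards [hU] with y hy
    rw [Function.comp, ← hh y hy, hPdef, F.hor_hor]
  rw [mvfderiv_congr e2, mvfderiv_clm_apply (hhd.clm_apply (hP P hXh)) (hP Q hYh),
    mvfderiv_clm_apply hhd (hP P hXh), hhW, hPW P hXh, hPW Q hYh] at e1
  simp only [zero_apply, zero_add, Function.comp] at e1
  rw [← hh x hxc, ← hh x hxc, F.inner_hor_left, hD.mlieBracket_eq hW hXh,
    hD.mlieBracket_eq hW hYh] at e1
  simp only [hPdef, hQdef, Foliation.hor_hor, inner_sub_left, inner_sub_right] at e1
  linarith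

end LeviCivita

/-! ### The Bott connection and its torsion -/

section Bott

variable {n : ℕ} {E : Type*} [NormedAddCommGroup E] [NormedSpace ℝ E] [FiniteDimensional ℝ E]
  {M : Type*} [TopologicalSpace M] [ChartedSpace E M] [IsManifold 𝓘(ℝ, E) ∞ M]
  [RiemannianBundle (fun x : M ↦ TangentSpace 𝓘(ℝ, E) x)]
  [IsContMDiffRiemannianBundle 𝓘(ℝ, E) ∞ E (fun x : M ↦ TangentSpace 𝓘(ℝ, E) x)]
  {F : Foliation n E M} {X Y Z W : Π y : M, TangentSpace 𝓘(ℝ, E) y} {x : M}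
  {D : CovariantDerivative 𝓘(ℝ, E) E (fun x : M ↦ TangentSpace 𝓘(ℝ, E) x)}

lemma cov_eq_hor_add_ver (hF : F.IsBundleLike) (hX : SmoothNear X x) (v : Tan E x) :
    D X x v = D (fun y ↦ F.hor y (X y)) x v + D (fun y ↦ F.ver y (X y)) x v := by
  have h : X = (fun y ↦ F.hor y (X y)) + (fun y ↦ F.ver y (X y)) := by
    funext y
    exact (F.hor_add_ver (X y)).symm
  conv_lhs => rw [h]
  rw [D.isCovariantDerivativeOn.add (s := Set.univ) (hX.hor hF).mdifferentiableAt
    (hX.ver hF).mdifferentiableAt]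
  rfl

/-- The Bott connection in terms of the Levi-Civita connection only. -/
lemma bott_eq_cov (hD : IsLeviCivita D) (hF : F.IsBundleLike) (hF' : F.IsTotallyGeodesic D)
    (hX : SmoothNear X x) (hY : SmoothNear Y x) :
    bott F D X Y x = F.hor x (D (fun y ↦ F.hor y (Y y)) x (X x)) +
      F.ver x (D (fun y ↦ F.ver y (Y y)) x (X x)) -
      F.hor x (D (fun y ↦ F.ver y (X y)) x (F.hor x (Y x))) := by
  rw [bott, hD.mlieBracket_eq (hX.ver hF) (hY.hor hF), hD.mlieBracket_eq (hX.hor hF) (hY.ver hF),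
    map_sub, map_sub, hF'.ver_cov_hor hD hF hX (F.ver_mem _)]
  have h1 := congrArg (fun v ↦ F.hor x (D (fun y ↦ F.hor y (Y y)) x v)) (F.hor_add_ver (X x))
  have h2 := congrArg (fun v ↦ F.ver x (D (fun y ↦ F.ver y (Y y)) x v)) (F.hor_add_ver (X x))
  simp only [map_add] at h1 h2
  rw [← h1, ← h2]
  abel

/-- The torsion of the Bott connection is, up to sign, the vertical part of the Lie bracket of the
horizontal parts. -/
lemma bottTorsion_eq_cov (hD : IsLeviCivita D) (hF : F.IsBundleLike) (hF' : F.IsTotallyGeodesic D)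
    (hX : SmoothNear X x) (hY : SmoothNear Y x) :
    bottTorsion F D X Y x = F.ver x (D (fun y ↦ F.hor y (X y)) x (F.hor x (Y x)) -
      D (fun y ↦ F.hor y (Y y)) x (F.hor x (X x))) := by
  have key : ∀ P Q : Π y : M, TangentSpace 𝓘(ℝ, E) y, SmoothNear P x → SmoothNear Q x →
      F.hor x (D (fun y ↦ F.hor y (P y)) x (Q x)) + F.ver x (D (fun y ↦ F.ver y (P y)) x (Q x)) +
      F.hor x (D (fun y ↦ F.ver y (P y)) x (F.hor x (Q x))) +
      F.ver x (D (fun y ↦ F.hor y (P y)) x (F.hor x (Q x))) = D P x (Q x) := by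
    intro P Q hP hQ
    have h1 := congrArg (fun v ↦ F.ver x (D (fun y ↦ F.hor y (P y)) x v)) (F.hor_add_ver (Q x))
    have h2 := congrArg (fun v ↦ F.hor x (D (fun y ↦ F.ver y (P y)) x v)) (F.hor_add_ver (Q x))
    simp only [map_add] at h1 h2
    rw [hF'.ver_cov_hor hD hF hP (F.ver_mem _), add_zero] at h1
    rw [F.hor_eq_zero (hF'.cov_ver_mem hF hP (F.ver_mem _)), add_zero] at h2
    rw [h1, h2, cov_eq_hor_add_ver hF hP,
      ← F.hor_add_ver (D (fun y ↦ F.hor y (P y)) x (Q x)),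
      ← F.hor_add_ver (D (fun y ↦ F.ver y (P y)) x (Q x))]
    simp only [map_add, Foliation.hor_hor, Foliation.ver_ver, Foliation.hor_ver,
      Foliation.ver_hor]
    abel
  rw [bottTorsion, Pi.sub_apply, Pi.sub_apply, bott_eq_cov hD hF hF' hX hY,
    bott_eq_cov hD hF hF' hY hX, hD.mlieBracket_eq hX hY, ← key Y X hY hX, ← key X Y hX hY, map_sub]
  abel

/-- The vertical part of `D_X Y - D_Y X`, for `X`, `Y` horizontal, is twice that of `D_X Y`,
since the latter is skew-symmetric for a bundle-like metric. -/
lemma inner_bottTorsion (hD : IsLeviCivita D) (hF : F.IsBundleLike) (hF' : F.IsTotallyGeodesic D)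
    (hX : SmoothNear X x) (hY : SmoothNear Y x) (hZ : SmoothNear Z x) :
    (inner ℝ (Z x) (bottTorsion F D X Y x) : ℝ) =
      2 * inner ℝ (D (fun y ↦ F.ver y (Z y)) x (F.hor x (X x))) (F.hor x (Y x)) := by
  have h1 := hD.inner_cov_ver_hor hF hZ hX (F.hor x (Y x))
  have h2 := hD.inner_cov_ver_hor hF hZ hY (F.hor x (X x))
  have h3 := hD.inner_cov_ver_skew hF hX hY hZ
  rw [real_inner_comm (D _ x _)] at h3
  rw [bottTorsion_eq_cov hD hF hF' hX hY, ← F.inner_ver_left, inner_sub_right]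
  linarith

omit [IsContMDiffRiemannianBundle 𝓘(ℝ, E) ∞ E (fun x : M ↦ TangentSpace 𝓘(ℝ, E) x)] in
lemma bottTorsion_swap : bottTorsion F D Y X x = - bottTorsion F D X Y x := by
  have h : mlieBracket 𝓘(ℝ, E) Y X x = - mlieBracket 𝓘(ℝ, E) X Y x := mlieBracket_swap_apply
  simp only [bottTorsion, Pi.sub_apply, h]
  abel

lemma hor_bottTorsion (hD : IsLeviCivita D) (hF : F.IsBundleLike) (hF' : F.IsTotallyGeodesic D)
    (hX : SmoothNear X x) (hY : SmoothNear Y x) : F.hor x (bottTorsion F D X Y x) = 0 := by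
  rw [bottTorsion_eq_cov hD hF hF' hX hY, F.hor_ver]

/-- The torsion of the Bott connection is tensorial. -/
lemma torsionAt_eq (hD : IsLeviCivita D) (hF : F.IsBundleLike) (hF' : F.IsTotallyGeodesic D)
    (hX : SmoothNear X x) (hY : SmoothNear Y x) :
    torsionAt F D x (X x) (Y x) = bottTorsion F D X Y x := by
  refine ext_inner_left ℝ fun w ↦ ?_
  have h1 := inner_bottTorsion hD hF hF' hX hY (smoothNear_ext w)
  have h2 := inner_bottTorsion hD hF hF' (smoothNear_ext (X x)) (smoothNear_ext (Y x))
    (smoothNear_ext w)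
  rw [FiberBundle.extend_apply_self] at h1
  simp only [FiberBundle.extend_apply_self] at h2
  rw [h1, ← h2]
  rfl

lemma inner_torsionAt (hD : IsLeviCivita D) (hF : F.IsBundleLike) (hF' : F.IsTotallyGeodesic D)
    (hZ : SmoothNear Z x) (u v : Tan E x) :
    (inner ℝ (Z x) (torsionAt F D x u v) : ℝ) =
      2 * inner ℝ (D (fun y ↦ F.ver y (Z y)) x (F.hor x u)) (F.hor x v) := by
  have := inner_bottTorsion hD hF hF' (smoothNear_ext u) (smoothNear_ext v) hZ
  simp only [FiberBundle.extend_apply_self] at this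
  exact this

omit [IsContMDiffRiemannianBundle 𝓘(ℝ, E) ∞ E (fun x : M ↦ TangentSpace 𝓘(ℝ, E) x)]
  [IsManifold 𝓘(ℝ, E) ∞ M] in
lemma sum_inner_horBasis_smul (v : Tan E x) :
    ∑ i, (inner ℝ (horBasis F x i : Tan E x) v : ℝ) • (horBasis F x i : Tan E x) = F.hor x v := by
  have h := congrArg Subtype.val ((horBasis F x).sum_repr' ⟨F.hor x v, F.hor_mem v⟩)
  rw [AddSubmonoidClass.coe_finsetSum] at h
  refine Eq.trans (Finset.sum_congr rfl fun i _ ↦ ?_) h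
  rw [Submodule.coe_smul, Submodule.coe_inner, ← F.inner_hor_left,
    F.hor_eq_self (horBasis F x i).2]

/-- The endomorphism `J_Z` is given by the derivative of the vertical part of `Z`. -/
lemma J_apply (hD : IsLeviCivita D) (hF : F.IsBundleLike) (hF' : F.IsTotallyGeodesic D)
    (hZ : SmoothNear Z x) (u : Tan E x) :
    J F D x (Z x) u = (2 : ℝ) • F.hor x (D (fun y ↦ F.ver y (Z y)) x (F.hor x u)) := by
  have hT : ∀ i j, (inner ℝ (F.ver x (Z x))
      (torsionAt F D x (horBasis F x i : Tan E x) (horBasis F x j : Tan E x)) : ℝ) =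
      2 * inner ℝ (horBasis F x j : Tan E x)
        (D (fun y ↦ F.ver y (Z y)) x (horBasis F x i : Tan E x)) := by
    intro i j
    have := inner_torsionAt hD hF hF' (hZ.ver hF) (horBasis F x i : Tan E x)
      (horBasis F x j : Tan E x)
    simp only [Foliation.ver_ver] at this
    rw [this, F.hor_eq_self (horBasis F x i).2, F.hor_eq_self (horBasis F x j).2,
      real_inner_comm]
  calc J F D x (Z x) u
      = ∑ i, (2 * inner ℝ (horBasis F x i : Tan E x) u : ℝ) • ∑ j, (inner ℝ
          (horBasis F x j : Tan E x) (D (fun y ↦ F.ver y (Z y)) x (horBasis F x i : Tan E x)) : ℝ) •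
            (horBasis F x j : Tan E x) := by
        simp only [J, sum_apply, smul_apply,
          ContinuousLinearMap.smulRight_apply, innerSL_apply_apply, hT, Finset.smul_sum, smul_smul]
        refine Finset.sum_congr rfl fun i _ ↦ Finset.sum_congr rfl fun j _ ↦ ?_
        congr 1
        ring
    _ = _ := by
        simp only [sum_inner_horBasis_smul]
        rw [← sum_inner_horBasis_smul u]
        simp only [map_sum, map_smul, Finset.smul_sum, smul_smul]

/-- The equation defining `J_Z` holds without restriction on the vectors: `T` takes vertical values
and only depends on the horizontal parts of its arguments. -/
lemma inner_J (hD : IsLeviCivita D) (hF : F.IsBundleLike) (hF' : F.IsTotallyGeodesic D)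
    (z u v : Tan E x) :
    (inner ℝ (J F D x z u) v : ℝ) = inner ℝ z (torsionAt F D x u v) := by
  have h1 := J_apply hD hF hF' (smoothNear_ext z) u
  have h2 := inner_torsionAt hD hF hF' (smoothNear_ext z) u v
  rw [FiberBundle.extend_apply_self] at h1 h2
  rw [h1, h2, inner_smul_left, F.inner_hor_left]
  rfl

omit [IsContMDiffRiemannianBundle 𝓘(ℝ, E) ∞ E (fun x : M ↦ TangentSpace 𝓘(ℝ, E) x)] in
lemma J_eq_zero {z : Tan E x} (hz : z ∈ F.horizontal x) : J F D x z = 0 := by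
  simp [J, F.ver_eq_zero hz]

/-- The Bott connection is `-½ J` plus the direct sum of the connections induced by the Levi-Civita
connection on the horizontal and the vertical bundle. -/
lemma bott_eq_sub_J (hD : IsLeviCivita D) (hF : F.IsBundleLike) (hF' : F.IsTotallyGeodesic D)
    (hX : SmoothNear X x) (hY : SmoothNear Y x) :
    bott F D X Y x = F.hor x (D (fun y ↦ F.hor y (Y y)) x (X x)) +
      F.ver x (D (fun y ↦ F.ver y (Y y)) x (X x)) - (1 / 2 : ℝ) • J F D x (X x) (Y x) := by
  rw [bott_eq_cov hD hF hF' hX hY, J_apply hD hF hF' hX, smul_smul]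
  norm_num

end Bott

/-! ### The derivative of the torsion and the curvature of the adjoint connection -/

section BottCurvature

variable {n : ℕ} {E : Type*} [NormedAddCommGroup E] [NormedSpace ℝ E] [FiniteDimensional ℝ E]
  {M : Type*} [TopologicalSpace M] [ChartedSpace E M] [IsManifold 𝓘(ℝ, E) ∞ M]
  [RiemannianBundle (fun x : M ↦ TangentSpace 𝓘(ℝ, E) x)]
  [IsContMDiffRiemannianBundle 𝓘(ℝ, E) ∞ E (fun x : M ↦ TangentSpace 𝓘(ℝ, E) x)]
  {F : Foliation n E M} {X Y Z W : Π y : M, TangentSpace 𝓘(ℝ, E) y} {x : M}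
  {D : CovariantDerivative 𝓘(ℝ, E) E (fun x : M ↦ TangentSpace 𝓘(ℝ, E) x)}

omit [IsManifold 𝓘(ℝ, E) ∞ M]
  [IsContMDiffRiemannianBundle 𝓘(ℝ, E) ∞ E (fun x : M ↦ TangentSpace 𝓘(ℝ, E) x)] in
lemma inner_eq_hor_add_ver (u v : Tan E x) :
    (inner ℝ u v : ℝ) = inner ℝ (F.hor x u) (F.hor x v) + inner ℝ (F.ver x u) (F.ver x v) := by
  rw [F.inner_hor_left, F.inner_ver_left, Foliation.hor_hor, Foliation.ver_ver, ← inner_add_right,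
    F.hor_add_ver]

variable (F D) in
/-- The vector field `J_X Y`. -/
noncomputable def jField (X Y : Π y : M, Tan E y) : Π y : M, Tan E y := fun y ↦ J F D y (X y) (Y y)

lemma SmoothNear.jField (hD : IsLeviCivita D) (hF : F.IsBundleLike) (hF' : F.IsTotallyGeodesic D)
    (hX : SmoothNear X x) (hY : SmoothNear Y x) : SmoothNear (jField F D X Y) x := by
  refine ((((hY.hor hF).cov hD (hX.ver hF)).hor hF).const_smul 2).congr ?_
  filter_upwards [hX.eventually] with y hy
  exact J_apply hD hF hF' hy _

lemma SmoothNear.bott (hD : IsLeviCivita D) (hF : F.IsBundleLike) (hF' : F.IsTotallyGeodesic D)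
    (hX : SmoothNear X x) (hY : SmoothNear Y x) : SmoothNear (bott F D X Y) x := by
  refine ((((hX.cov hD (hY.hor hF)).hor hF).add ((hX.cov hD (hY.ver hF)).ver hF)).sub
    (((hY.hor hF).cov hD (hX.ver hF)).hor hF)).congr ?_
  filter_upwards [hX.eventually, hY.eventually] with y hy hy'
  exact bott_eq_cov hD hF hF' hy hy'

lemma SmoothNear.bottTorsion (hD : IsLeviCivita D) (hF : F.IsBundleLike)
    (hF' : F.IsTotallyGeodesic D) (hX : SmoothNear X x) (hY : SmoothNear Y x) :
    SmoothNear (bottTorsion F D X Y) x :=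
  ((hX.bott hD hF hF' hY).sub (hY.bott hD hF hF' hX)).sub (hX.mlieBracket hY)

lemma inner_jField (hD : IsLeviCivita D) (hF : F.IsBundleLike) (hF' : F.IsTotallyGeodesic D)
    (hY : SmoothNear Y x) (hZ : SmoothNear Z x) :
    (inner ℝ (jField F D X Y x) (Z x) : ℝ) = inner ℝ (X x) (bottTorsion F D Y Z x) := by
  rw [jField, inner_J hD hF hF', torsionAt_eq hD hF hF' hY hZ]

/-- The Bott connection is metric. Indeed it differs by the skew-symmetric operators `-½ J_X` from
the direct sum of the connections induced by the Levi-Civita connection on the horizontal and the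
vertical bundle. -/
lemma mvfderiv_inner_eq_bott (hD : IsLeviCivita D) (hF : F.IsBundleLike)
    (hF' : F.IsTotallyGeodesic D) (hX : SmoothNear X x) (hY : SmoothNear Y x)
    (hZ : SmoothNear Z x) :
    mvfderiv 𝓘(ℝ, E) (fun y ↦ (inner ℝ (Y y) (Z y) : ℝ)) x (X x) =
      inner ℝ (bott F D X Y x) (Z x) + inner ℝ (Y x) (bott F D X Z x) := by
  have h1 := hD.mvfderiv_inner (hY.hor hF) (hZ.hor hF) (X x)
  have h2 := hD.mvfderiv_inner (hY.ver hF) (hZ.ver hF) (X x)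
  have h3 : (fun y ↦ (inner ℝ (Y y) (Z y) : ℝ)) =
      (fun y ↦ (inner ℝ (F.hor y (Y y)) (F.hor y (Z y)) : ℝ)) +
        fun y ↦ (inner ℝ (F.ver y (Y y)) (F.ver y (Z y)) : ℝ) := by
    funext y
    exact inner_eq_hor_add_ver _ _
  have h4 := inner_jField (X := X) hD hF hF' hY hZ
  have h5 := inner_jField (X := X) hD hF hF' hZ hY
  rw [bottTorsion_swap, inner_neg_right, ← h4, real_inner_comm] at h5
  rw [h3, mvfderiv_add
    (((hY.hor hF).inner (hZ.hor hF)).self_of_nhds.mdifferentiableAt (by simp))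
    (((hY.ver hF).inner (hZ.ver hF)).self_of_nhds.mdifferentiableAt (by simp)),
    add_apply, h1, h2, bott_eq_sub_J hD hF hF' hX hY, bott_eq_sub_J hD hF hF' hX hZ]
  simp only [jField] at h4 h5
  simp only [inner_add_left, inner_sub_left, inner_add_right, inner_sub_right, inner_smul_left,
    inner_smul_right, F.inner_hor_left, F.inner_ver_left, RCLike.conj_to_real, h5]
  simp only [← F.inner_hor_left (Y x), ← F.inner_ver_left (Y x)]
  ring

/-- The Bott connection preserves the vertical bundle. -/
lemma hor_bott_eq_zero (hD : IsLeviCivita D) (hF : F.IsBundleLike) (hF' : F.IsTotallyGeodesic D)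
    (hX : SmoothNear X x) (hY : SmoothNear Y x) (h : ∀ᶠ y in 𝓝 x, F.hor y (Y y) = 0) :
    F.hor x (bott F D X Y x) = 0 := by
  have h0 : D (fun y ↦ F.hor y (Y y)) x = 0 := by
    rw [D.isCovariantDerivativeOn.congr_of_eventuallyEq (σ' := 0) (hY.hor hF).mdifferentiableAt
      (mdifferentiableAt_zeroSection ..) Filter.univ_mem h]
    simp
  rw [bott_eq_cov hD hF hF' hX hY, h0, h.self_of_nhds]
  simp

/-- The additivity of the Bott connection in the differentiated field follows from its being
metric. -/
lemma bott_add (hD : IsLeviCivita D) (hF : F.IsBundleLike) (hF' : F.IsTotallyGeodesic D)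
    (hX : SmoothNear X x) (hY : SmoothNear Y x) (hZ : SmoothNear Z x) :
    bott F D X (Y + Z) x = bott F D X Y x + bott F D X Z x := by
  refine ext_inner_right ℝ fun w ↦ ?_
  have hw := smoothNear_ext w
  have h1 := mvfderiv_inner_eq_bott hD hF hF' hX hY hw
  have h2 := mvfderiv_inner_eq_bott hD hF hF' hX hZ hw
  have h3 := mvfderiv_inner_eq_bott hD hF hF' hX (hY.add hZ) hw
  simp only [Pi.add_apply, inner_add_left] at h3
  rw [mvfderiv_fun_add ((hY.inner hw).self_of_nhds.mdifferentiableAt (by simp))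
    ((hZ.inner hw).self_of_nhds.mdifferentiableAt (by simp)), add_apply, h1, h2] at h3
  simp only [FiberBundle.extend_apply_self] at h3
  rw [inner_add_left]
  linarith

lemma bott_const_smul (hD : IsLeviCivita D) (hF : F.IsBundleLike) (hF' : F.IsTotallyGeodesic D)
    (hX : SmoothNear X x) (hY : SmoothNear Y x) (a : ℝ) :
    bott F D X (a • Y) x = a • bott F D X Y x := by
  refine ext_inner_right ℝ fun w ↦ ?_
  have hw := smoothNear_ext w
  have h1 := mvfderiv_inner_eq_bott hD hF hF' hX hY hw
  have h3 := mvfderiv_inner_eq_bott hD hF hF' hX (hY.const_smul a) hw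
  simp only [Pi.smul_apply, inner_smul_left, RCLike.conj_to_real] at h3
  rw [mvfderiv_fun_mul mdifferentiableAt_const
    ((hY.inner hw).self_of_nhds.mdifferentiableAt (by simp)), mvfderiv_const] at h3
  simp only [smul_zero, add_zero, smul_apply, h1, FiberBundle.extend_apply_self, smul_eq_mul] at h3
  rw [inner_smul_left, RCLike.conj_to_real]
  linarith

/-- The derivative of the tensor `J` is dual to the derivative of the torsion. -/
lemma inner_bott_jField (hD : IsLeviCivita D) (hF : F.IsBundleLike) (hF' : F.IsTotallyGeodesic D)
    (hX : SmoothNear X x) (hY : SmoothNear Y x) (hZ : SmoothNear Z x) (hW : SmoothNear W x) :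
    (inner ℝ (bott F D X (jField F D Y Z) x) (W x) : ℝ) =
      inner ℝ (jField F D Y (bott F D X Z) x) (W x) +
        inner ℝ (bott F D X Y x) (bottTorsion F D Z W x) +
        inner ℝ (Y x) (covTorsion F D X Z W x) := by
  have h1 := mvfderiv_inner_eq_bott hD hF hF' hX (hY.jField hD hF hF' hZ) hW
  have h2 := mvfderiv_inner_eq_bott hD hF hF' hX hY (hZ.bottTorsion hD hF hF' hW)
  have h3 : (fun y ↦ (inner ℝ (jField F D Y Z y) (W y) : ℝ)) =ᶠ[𝓝 x]
      fun y ↦ (inner ℝ (Y y) (bottTorsion F D Z W y) : ℝ) := by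
    filter_upwards [hZ.eventually, hW.eventually] with y hz hw
    exact inner_jField hD hF hF' hz hw
  rw [mvfderiv_congr h3, h2, inner_jField hD hF hF' hZ (hX.bott hD hF hF' hW)] at h1
  rw [inner_jField hD hF hF' (hX.bott hD hF hF' hZ) hW, covTorsion, Pi.sub_apply, Pi.sub_apply,
    inner_sub_right, inner_sub_right]
  linarith

lemma hor_covTorsion (hD : IsLeviCivita D) (hF : F.IsBundleLike) (hF' : F.IsTotallyGeodesic D)
    (hX : SmoothNear X x) (hY : SmoothNear Y x) (hZ : SmoothNear Z x) :
    F.hor x (covTorsion F D X Y Z x) = 0 := by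
  have h : ∀ᶠ y in 𝓝 x, F.hor y (bottTorsion F D Y Z y) = 0 := by
    filter_upwards [hY.eventually, hZ.eventually] with y h1 h2
    exact hor_bottTorsion hD hF hF' h1 h2
  rw [covTorsion, Pi.sub_apply, Pi.sub_apply, map_sub, map_sub,
    hor_bott_eq_zero hD hF hF' hX (hY.bottTorsion hD hF hF' hZ) h,
    hor_bottTorsion hD hF hF' (hX.bott hD hF hF' hY) hZ,
    hor_bottTorsion hD hF hF' hY (hX.bott hD hF hF' hZ)]
  simp

lemma covTorsion_swap (hD : IsLeviCivita D) (hF : F.IsBundleLike) (hF' : F.IsTotallyGeodesic D)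
    (hX : SmoothNear X x) (hY : SmoothNear Y x) (hZ : SmoothNear Z x) :
    covTorsion F D X Z Y x = - covTorsion F D X Y Z x := by
  have h : bottTorsion F D Z Y = (-1 : ℝ) • bottTorsion F D Y Z := by
    funext y
    simp [bottTorsion_swap (X := Y) (Y := Z)]
  simp only [covTorsion, Pi.sub_apply]
  rw [h, bott_const_smul hD hF hF' hX (hY.bottTorsion hD hF hF' hZ),
    bottTorsion_swap (X := Y), bottTorsion_swap (Y := Z)]
  module

/-- The curvature of the adjoint connection, in terms of the curvature and the torsion of the Bott
connection. The terms with `J_{∇_X Y}`, `J_{∇_Y X}` and `J_{[X, Y]}` combine to `J_{T(X, Y)}`. -/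
lemma inner_curvature_adjointConn (hD : IsLeviCivita D) (hF : F.IsBundleLike)
    (hF' : F.IsTotallyGeodesic D) (hX : SmoothNear X x) (hY : SmoothNear Y x)
    (hZ : SmoothNear Z x) (hW : SmoothNear W x) (ε : ℝ) :
    (inner ℝ (curvature (adjointConn F D ε) X Y Z x) (W x) : ℝ) =
      inner ℝ (curvature (bott F D) X Y Z x) (W x) +
      (1 / ε) * (inner ℝ (bottTorsion F D X Y x) (bottTorsion F D Z W x) +
        inner ℝ (Y x) (covTorsion F D X Z W x) - inner ℝ (X x) (covTorsion F D Y Z W x)) +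
      (1 / ε) ^ 2 * (inner ℝ (J F D x (X x) (J F D x (Y x) (Z x))) (W x) -
        inner ℝ (J F D x (Y x) (J F D x (X x) (Z x))) (W x)) := by
  have hadj : ∀ A B : Π y : M, TangentSpace 𝓘(ℝ, E) y,
      adjointConn F D ε A B = bott F D A B + (1 / ε) • jField F D A B := fun _ _ ↦ rfl
  have h1 := inner_bott_jField hD hF hF' hX hY hZ hW
  have h2 := inner_bott_jField hD hF hF' hY hX hZ hW
  have h3 : (inner ℝ (J F D x (mlieBracket 𝓘(ℝ, E) X Y x) (Z x)) (W x) : ℝ) =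
      inner ℝ (mlieBracket 𝓘(ℝ, E) X Y x) (bottTorsion F D Z W x) :=
    inner_jField (X := mlieBracket 𝓘(ℝ, E) X Y) hD hF hF' hZ hW
  have h4 : (inner ℝ (bottTorsion F D X Y x) (bottTorsion F D Z W x) : ℝ) =
      inner ℝ (bott F D X Y x) (bottTorsion F D Z W x) -
      inner ℝ (bott F D Y X x) (bottTorsion F D Z W x) -
      inner ℝ (mlieBracket 𝓘(ℝ, E) X Y x) (bottTorsion F D Z W x) := by
    rw [← inner_sub_left, ← inner_sub_left]
    rfl
  have h5 : ∀ A B : Π y : M, TangentSpace 𝓘(ℝ, E) y, SmoothNear A x → SmoothNear B x →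
      adjointConn F D ε A (adjointConn F D ε B Z) x = bott F D A (bott F D B Z) x +
        (1 / ε) • bott F D A (jField F D B Z) x +
        (1 / ε) • J F D x (A x) (bott F D B Z x) +
        (1 / ε) ^ 2 • J F D x (A x) (J F D x (B x) (Z x)) := by
    intro A B hA hB
    rw [hadj B Z, hadj A, Pi.add_apply, Pi.smul_apply, bott_add hD hF hF' hA
      (hB.bott hD hF hF' hZ) ((hB.jField hD hF hF' hZ).const_smul _), bott_const_smul hD hF hF' hA
      (hB.jField hD hF hF' hZ)]
    simp only [jField, Pi.add_apply, Pi.smul_apply, map_add, map_smul]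
    module
  have h6 : adjointConn F D ε (mlieBracket 𝓘(ℝ, E) X Y) Z x =
      bott F D (mlieBracket 𝓘(ℝ, E) X Y) Z x +
        (1 / ε) • J F D x (mlieBracket 𝓘(ℝ, E) X Y x) (Z x) := rfl
  simp only [curvature, Pi.sub_apply]
  rw [h5 X Y hX hY, h5 Y X hY hX, h6]
  simp only [inner_sub_left, inner_add_left, inner_smul_left, RCLike.conj_to_real]
  rw [h1, h2, h3, h4]
  simp only [jField]
  ring

end BottCurvature

/-! ### The horizontal Ricci curvature -/

section Ricci

variable {n : ℕ} {E : Type*} [NormedAddCommGroup E] [NormedSpace ℝ E] [FiniteDimensional ℝ E]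
  {M : Type*} [TopologicalSpace M] [ChartedSpace E M] [IsManifold 𝓘(ℝ, E) ∞ M]
  [RiemannianBundle (fun x : M ↦ TangentSpace 𝓘(ℝ, E) x)]
  [IsContMDiffRiemannianBundle 𝓘(ℝ, E) ∞ E (fun x : M ↦ TangentSpace 𝓘(ℝ, E) x)]
  {F : Foliation n E M} {X Y Z W : Π y : M, TangentSpace 𝓘(ℝ, E) y} {x : M}
  {D : CovariantDerivative 𝓘(ℝ, E) E (fun x : M ↦ TangentSpace 𝓘(ℝ, E) x)}

/-- The curvature of the Bott connection is skew-symmetric, as this connection is metric. -/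
lemma inner_curvature_bott_self (hD : IsLeviCivita D) (hF : F.IsBundleLike)
    (hF' : F.IsTotallyGeodesic D) (hX : SmoothNear X x) (hY : SmoothNear Y x)
    (hZ : SmoothNear Z x) :
    (inner ℝ (curvature (bott F D) X Y Z x) (Z x) : ℝ) = 0 := by
  -- `A (B ⟨Z, Z⟩)`; its part symmetric in `A` and `B` does not contribute to the curvature
  have key : ∀ A B : Π y : M, TangentSpace 𝓘(ℝ, E) y, SmoothNear A x → SmoothNear B x →
      mvfderiv 𝓘(ℝ, E) (fun y ↦
        mvfderiv 𝓘(ℝ, E) (fun y ↦ (inner ℝ (Z y) (Z y) : ℝ)) y (B y)) x (A x) =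
      2 * (inner ℝ (bott F D A (bott F D B Z) x) (Z x) +
        inner ℝ (bott F D B Z x) (bott F D A Z x)) := by
    intro A B hA hB
    have hBZ := hB.bott hD hF hF' hZ
    have h1 : (fun y ↦ mvfderiv 𝓘(ℝ, E) (fun y ↦ (inner ℝ (Z y) (Z y) : ℝ)) y (B y)) =ᶠ[𝓝 x]
        fun y ↦ (inner ℝ (bott F D B Z y) (Z y) : ℝ) + inner ℝ (bott F D B Z y) (Z y) := by
      filter_upwards [hB.eventually, hZ.eventually] with y hb hz
      rw [mvfderiv_inner_eq_bott hD hF hF' hb hz hz, real_inner_comm (Z y)]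
    have h2 := (hBZ.inner hZ).self_of_nhds.mdifferentiableAt (n := ∞) (by simp)
    rw [mvfderiv_congr h1, mvfderiv_fun_add h2 h2, add_apply,
      mvfderiv_inner_eq_bott hD hF hF' hA hBZ hZ]
    ring
  have h1 := mvfderiv_mlieBracket (hZ.inner hZ) hX hY
  rw [key X Y hX hY, key Y X hY hX, mvfderiv_inner_eq_bott hD hF hF' (hX.mlieBracket hY) hZ hZ]
    at h1
  have h2 := real_inner_comm (Z x) (bott F D (mlieBracket 𝓘(ℝ, E) X Y) Z x)
  have h3 := real_inner_comm (bott F D Y Z x) (bott F D X Z x)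
  simp only [curvature, Pi.sub_apply, inner_sub_left]
  linarith

lemma curvature_bott_swap (hD : IsLeviCivita D) (hF : F.IsBundleLike)
    (hF' : F.IsTotallyGeodesic D) (hX : SmoothNear X x) (hY : SmoothNear Y x)
    (hZ : SmoothNear Z x) :
    curvature (bott F D) Y X Z x = - curvature (bott F D) X Y Z x := by
  have h1 := bott_eq_sub_J hD hF hF' (hX.mlieBracket hY) hZ
  have h2 := bott_eq_sub_J hD hF hF' (hY.mlieBracket hX) hZ
  have h3 : mlieBracket 𝓘(ℝ, E) Y X x = - mlieBracket 𝓘(ℝ, E) X Y x := mlieBracket_swap_apply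
  have h4 : J F D x (- mlieBracket 𝓘(ℝ, E) X Y x) = - J F D x (mlieBracket 𝓘(ℝ, E) X Y x) := by
    simp only [J, map_neg, inner_neg_left, neg_smul, Finset.sum_neg_distrib]
  rw [h3, h4] at h2
  simp only [map_neg, neg_apply] at h2
  simp only [curvature, Pi.sub_apply]
  rw [h1, h2]
  module

/-- The first Bianchi identity for the Bott connection, horizontally: the torsion of the Bott
connection takes vertical values, hence does not contribute. -/
lemma hor_curvature_bott_cyclic (hD : IsLeviCivita D) (hF : F.IsBundleLike)
    (hF' : F.IsTotallyGeodesic D) (hX : SmoothNear X x) (hY : SmoothNear Y x)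
    (hZ : SmoothNear Z x) :
    F.hor x (curvature (bott F D) X Y Z x) + F.hor x (curvature (bott F D) Y Z X x) +
      F.hor x (curvature (bott F D) Z X Y x) = 0 := by
  -- `π_𝓗 [A, [B, C]]` in terms of `∇`; the torsion and its derivatives are vertical
  have key : ∀ A B C : Π y : M, TangentSpace 𝓘(ℝ, E) y, SmoothNear A x → SmoothNear B x →
      SmoothNear C x →
      F.hor x (bott F D A (bott F D B C) x) - F.hor x (bott F D A (bott F D C B) x) -
        F.hor x (bott F D (mlieBracket 𝓘(ℝ, E) B C) A x) =
      F.hor x (mlieBracket 𝓘(ℝ, E) A (mlieBracket 𝓘(ℝ, E) B C) x) := by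
    intro A B C hA hB hC
    have hBC := hB.mlieBracket hC
    have h1 : bott F D B C = bott F D C B + (bottTorsion F D B C + mlieBracket 𝓘(ℝ, E) B C) := by
      simp only [bottTorsion]
      abel
    have h2 : bott F D A (mlieBracket 𝓘(ℝ, E) B C) x = bottTorsion F D A (mlieBracket 𝓘(ℝ, E) B C) x
        + bott F D (mlieBracket 𝓘(ℝ, E) B C) A x
        + mlieBracket 𝓘(ℝ, E) A (mlieBracket 𝓘(ℝ, E) B C) x := by
      simp only [bottTorsion, Pi.sub_apply]
      abel
    have h3 : ∀ᶠ y in 𝓝 x, F.hor y (bottTorsion F D B C y) = 0 := by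
      filter_upwards [hB.eventually, hC.eventually] with y h1 h2
      exact hor_bottTorsion hD hF hF' h1 h2
    have hT := hB.bottTorsion hD hF hF' hC
    rw [h1, bott_add hD hF hF' hA (hC.bott hD hF hF' hB) (hT.add hBC), bott_add hD hF hF' hA hT hBC,
      h2]
    simp only [map_add, hor_bott_eq_zero hD hF hF' hA hT h3, hor_bottTorsion hD hF hF' hA hBC]
    abel
  have hJ : mlieBracket 𝓘(ℝ, E) X (mlieBracket 𝓘(ℝ, E) Y Z) x +
      mlieBracket 𝓘(ℝ, E) Y (mlieBracket 𝓘(ℝ, E) Z X) x +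
      mlieBracket 𝓘(ℝ, E) Z (mlieBracket 𝓘(ℝ, E) X Y) x = 0 := by
    have : IsManifold 𝓘(ℝ, E) (minSmoothness ℝ 3) M := by
      simpa using inferInstanceAs (IsManifold 𝓘(ℝ, E) 3 M)
    have h2 : minSmoothness ℝ 2 ≤ ∞ := by simpa using ENat.LEInfty.out
    have h := leibniz_identity_mlieBracket_apply (hX.contMDiffAt.of_le h2)
      (hY.contMDiffAt.of_le h2) (hZ.contMDiffAt.of_le h2)
    have h3 : mlieBracket 𝓘(ℝ, E) (mlieBracket 𝓘(ℝ, E) X Y) Z x =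
      - mlieBracket 𝓘(ℝ, E) Z (mlieBracket 𝓘(ℝ, E) X Y) x := mlieBracket_swap_apply
    have h4 : mlieBracket 𝓘(ℝ, E) X Z = (-1 : ℝ) • mlieBracket 𝓘(ℝ, E) Z X := by
      rw [neg_one_smul]
      exact mlieBracket_swap
    have h5 := mlieBracket_const_smul_right (V := Y) (c := (-1 : ℝ))
      (hZ.mlieBracket hX).mdifferentiableAt
    rw [h, h3, h4, h5]
    module
  have h1 := key X Y Z hX hY hZ
  have h2 := key Y Z X hY hZ hX
  have h3 := key Z X Y hZ hX hY
  have h4 := congrArg (F.hor x) hJ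
  simp only [map_add, map_zero] at h4
  rw [← h1, ← h2, ← h3] at h4
  rw [← h4]
  simp only [curvature, Pi.sub_apply, map_sub]
  abel

/-- The horizontal Ricci curvature of the Bott connection is symmetric: in the first Bianchi
identity for `X_i`, `u`, `v`, paired with `X_i`, the middle term vanishes by skew-symmetry. -/
lemma ricciH_bott_comm (hD : IsLeviCivita D) (hF : F.IsBundleLike)
    (hF' : F.IsTotallyGeodesic D) (u v : Tan E x) :
    ricciH F (bott F D) x u v = ricciH F (bott F D) x v u := by
  refine Finset.sum_congr rfl fun i _ ↦ ?_
  set e : Tan E x := (horBasis F x i : Tan E x) with he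
  have heh : F.hor x e = e := F.hor_eq_self (horBasis F x i).2
  have h1 := hor_curvature_bott_cyclic hD hF hF' (smoothNear_ext e) (smoothNear_ext u)
    (smoothNear_ext v)
  have h2 := congrArg (fun w ↦ (inner ℝ w e : ℝ)) h1
  have h3 := inner_curvature_bott_self hD hF hF' (smoothNear_ext u) (smoothNear_ext v)
    (smoothNear_ext e)
  rw [FiberBundle.extend_apply_self] at h3
  simp only [inner_add_left, F.inner_hor_left, heh, inner_zero_left] at h2
  rw [h3, curvature_bott_swap hD hF hF' (smoothNear_ext e) (smoothNear_ext v) (smoothNear_ext u),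
    inner_neg_left] at h2
  linarith

omit [IsManifold 𝓘(ℝ, E) ∞ M]
  [IsContMDiffRiemannianBundle 𝓘(ℝ, E) ∞ E (fun x : M ↦ TangentSpace 𝓘(ℝ, E) x)] in
/-- Parseval's identity for the horizontal components. -/
lemma sum_inner_horBasis (u v : Tan E x) :
    ∑ i, (inner ℝ u (horBasis F x i : Tan E x) * inner ℝ v (horBasis F x i : Tan E x) : ℝ) =
      inner ℝ (F.hor x u) v := by
  rw [← sum_inner_horBasis_smul u, sum_inner]
  refine Finset.sum_congr rfl fun i _ ↦ ?_
  rw [inner_smul_left, RCLike.conj_to_real, real_inner_comm u, real_inner_comm v]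

omit [IsManifold 𝓘(ℝ, E) ∞ M]
  [IsContMDiffRiemannianBundle 𝓘(ℝ, E) ∞ E (fun x : M ↦ TangentSpace 𝓘(ℝ, E) x)] in
/-- Parseval's identity for the vertical components. -/
lemma sum_inner_verBasis (u v : Tan E x) :
    ∑ l, (inner ℝ (verBasis F x l : Tan E x) u * inner ℝ (verBasis F x l : Tan E x) v : ℝ) =
      inner ℝ (F.ver x u) v := by
  have h := (verBasis F x).sum_inner_mul_inner ⟨F.ver x u, F.ver_mem u⟩ ⟨F.ver x v, F.ver_mem v⟩
  simp only [Submodule.coe_inner] at h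
  rw [F.inner_ver_left u (F.ver x v), Foliation.ver_ver, ← F.inner_ver_left] at h
  rw [← h]
  refine Finset.sum_congr rfl fun l _ ↦ ?_
  rw [F.inner_ver_left, ← F.inner_ver_left (verBasis F x l : Tan E x) v,
    F.ver_eq_self (verBasis F x l).2, real_inner_comm u]

variable (F D) in
/-- The endomorphism `𝐉²` is the contribution of the square of the torsion to the horizontal Ricci
curvature of the adjoint connection. -/
lemma inner_JSq (hD : IsLeviCivita D) (hF : F.IsBundleLike) (hF' : F.IsTotallyGeodesic D)
    (u v : Tan E x) :
    (inner ℝ (JSq F D x u) v : ℝ) = - ∑ i, inner ℝ (torsionAt F D x u (horBasis F x i : Tan E x))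
      (torsionAt F D x v (horBasis F x i : Tan E x)) := by
  have hhor : ∀ z w : Tan E x, F.hor x (J F D x z w) = J F D x z w := by
    intro z w
    have h := J_apply hD hF hF' (smoothNear_ext z) w
    rw [FiberBundle.extend_apply_self] at h
    rw [h, map_smul, Foliation.hor_hor]
  have hskew : ∀ z a b : Tan E x, (inner ℝ (J F D x z a) b : ℝ) = - inner ℝ a (J F D x z b) := by
    intro z a b
    rw [real_inner_comm (J F D x z b), inner_J hD hF hF', inner_J hD hF hF', torsionAt,
      bottTorsion_swap, inner_neg_right]
    rfl
  have hver : ∀ a b : Tan E x, F.ver x (torsionAt F D x a b) = torsionAt F D x a b := by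
    intro a b
    have h := hor_bottTorsion hD hF hF' (smoothNear_ext a) (smoothNear_ext b)
    have h' := F.hor_add_ver (torsionAt F D x a b)
    rwa [torsionAt, h, zero_add] at h'
  have key : ∀ l, (inner ℝ (J F D x (verBasis F x l : Tan E x)
      (J F D x (verBasis F x l : Tan E x) u)) v : ℝ) =
      - ∑ i, inner ℝ (verBasis F x l : Tan E x) (torsionAt F D x u (horBasis F x i : Tan E x)) *
        inner ℝ (verBasis F x l : Tan E x) (torsionAt F D x v (horBasis F x i : Tan E x)) := by
    intro l
    rw [hskew, ← hhor _ u, ← sum_inner_horBasis]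
    simp only [inner_J hD hF hF']
  simp only [JSq, sum_apply, ContinuousLinearMap.comp_apply, sum_inner]
  rw [Finset.sum_congr rfl fun l _ ↦ key l, Finset.sum_neg_distrib, Finset.sum_comm]
  simp only [sum_inner_verBasis, hver]

lemma inner_JSq_comm (hD : IsLeviCivita D) (hF : F.IsBundleLike) (hF' : F.IsTotallyGeodesic D)
    (u v : Tan E x) :
    (inner ℝ (JSq F D x u) v : ℝ) = inner ℝ u (JSq F D x v) := by
  rw [← real_inner_comm u, inner_JSq F D hD hF hF', inner_JSq F D hD hF hF']
  simp only [real_inner_comm]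

/-- The curvature formula of `inner_curvature_adjointConn`, traced over the horizontal space: the
term in `1 / ε ^ 2` vanishes since `J_Z = 0` for `Z` horizontal. -/
lemma ricciH_adjointConn (hD : IsLeviCivita D) (hF : F.IsBundleLike)
    (hF' : F.IsTotallyGeodesic D) (ε : ℝ) (u v : Tan E x) :
    ricciH F (adjointConn F D ε) x u v = ricciH F (bott F D) x u v -
      (1 / ε) * inner ℝ u (∑ j, covTorsion F D (ext (horBasis F x j : Tan E x))
        (ext (horBasis F x j : Tan E x)) (ext v) x) +
      (1 / ε) * inner ℝ (JSq F D x u) v := by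
  have key : ∀ i, (inner ℝ (curvature (adjointConn F D ε) (ext (horBasis F x i : Tan E x)) (ext u)
      (ext v) x) (horBasis F x i : Tan E x) : ℝ) =
      inner ℝ (curvature (bott F D) (ext (horBasis F x i : Tan E x)) (ext u) (ext v) x)
        (horBasis F x i : Tan E x) -
      (1 / ε) * inner ℝ u (covTorsion F D (ext (horBasis F x i : Tan E x))
        (ext (horBasis F x i : Tan E x)) (ext v) x) +
      (1 / ε) * - inner ℝ (torsionAt F D x u (horBasis F x i : Tan E x))
        (torsionAt F D x v (horBasis F x i : Tan E x)) := by
    intro i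
    set e : Tan E x := (horBasis F x i : Tan E x) with he
    have heh : e ∈ F.horizontal x := (horBasis F x i).2
    have hes := smoothNear_ext e
    have hus := smoothNear_ext u
    have hvs := smoothNear_ext v
    have h := inner_curvature_adjointConn hD hF hF' hes hus hvs hes ε
    rw [covTorsion_swap hD hF hF' hes hes hvs, bottTorsion_swap (X := ext u)] at h
    simp only [FiberBundle.extend_apply_self] at h
    have h0 : (inner ℝ e (covTorsion F D (ext u) (ext v) (ext e) x) : ℝ) = 0 := by
      have h1 := F.inner_hor_left e (covTorsion F D (ext u) (ext v) (ext e) x)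
      rwa [hor_covTorsion hD hF hF' hus hvs hes, inner_zero_right, F.hor_eq_self heh] at h1
    rw [J_eq_zero heh] at h
    rw [h, h0]
    simp only [zero_apply, map_zero, inner_zero_left, inner_neg_left, inner_neg_right, torsionAt]
    ring
  rw [ricciH, Finset.sum_congr rfl fun i _ ↦ key i, inner_JSq F D hD hF hF', ricciH, inner_sum,
    Finset.sum_add_distrib, Finset.sum_sub_distrib, Finset.mul_sum, ← Finset.sum_neg_distrib,
    Finset.mul_sum]

end Ricci

/-! ### Operators on one-forms -/

section Forms

variable {n : ℕ} {E : Type*} [NormedAddCommGroup E] [NormedSpace ℝ E] [FiniteDimensional ℝ E]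
  {M : Type*} [TopologicalSpace M] [ChartedSpace E M] [IsManifold 𝓘(ℝ, E) ∞ M]
  [RiemannianBundle (fun x : M ↦ TangentSpace 𝓘(ℝ, E) x)]
  [IsContMDiffRiemannianBundle 𝓘(ℝ, E) ∞ E (fun x : M ↦ TangentSpace 𝓘(ℝ, E) x)]
  {F : Foliation n E M} {x : M}
  {D : CovariantDerivative 𝓘(ℝ, E) E (fun x : M ↦ TangentSpace 𝓘(ℝ, E) x)}

omit [IsManifold 𝓘(ℝ, E) ∞ M]
  [IsContMDiffRiemannianBundle 𝓘(ℝ, E) ∞ E (fun x : M ↦ TangentSpace 𝓘(ℝ, E) x)] in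
lemma inner_flat_symm (η : Tan E x →L[ℝ] ℝ) (v : Tan E x) :
    (inner ℝ ((flat x).symm η) v : ℝ) = η v :=
  InnerProductSpace.toDual_symm_apply

omit [IsManifold 𝓘(ℝ, E) ∞ M]
  [IsContMDiffRiemannianBundle 𝓘(ℝ, E) ∞ E (fun x : M ↦ TangentSpace 𝓘(ℝ, E) x)] in
lemma onForms_apply (A : Tan E x →L[ℝ] Tan E x) (η : Tan E x →L[ℝ] ℝ) (v : Tan E x) :
    onForms A η v = inner ℝ (A ((flat x).symm η)) v :=
  rfl

omit [IsManifold 𝓘(ℝ, E) ∞ M]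
  [IsContMDiffRiemannianBundle 𝓘(ℝ, E) ∞ E (fun x : M ↦ TangentSpace 𝓘(ℝ, E) x)] in
lemma inner_metricAdjoint (A : Tan E x →L[ℝ] Tan E x) (u v : Tan E x) :
    (inner ℝ (metricAdjoint A u) v : ℝ) = inner ℝ u (A v) :=
  haveI : CompleteSpace (Tan E x) := FiniteDimensional.complete ℝ _
  ContinuousLinearMap.adjoint_inner_left A v u

omit [IsContMDiffRiemannianBundle 𝓘(ℝ, E) ∞ E (fun x : M ↦ TangentSpace 𝓘(ℝ, E) x)] in
lemma ricciOp_apply (C : (Π x : M, Tan E x) → (Π x : M, Tan E x) → Π x : M, Tan E x)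
    (η : Tan E x →L[ℝ] ℝ) (v : Tan E x) :
    ricciOp F C x η v = ∑ a, ∑ b, ricciH F C x (tanBasis x a) (tanBasis x b) *
      (inner ℝ ((flat x).symm η) (tanBasis x a) * inner ℝ (tanBasis x b) v) := by
  simp only [inner_flat_symm, ricciOp, sum_apply, smul_apply, ContinuousLinearMap.smulRight_apply,
    ContinuousLinearMap.apply_apply, innerSL_apply_apply, smul_eq_mul]

omit [IsManifold 𝓘(ℝ, E) ∞ M]
  [IsContMDiffRiemannianBundle 𝓘(ℝ, E) ∞ E (fun x : M ↦ TangentSpace 𝓘(ℝ, E) x)] in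
/-- A bilinear form `(u, v) ↦ ⟨u, A v⟩` is recovered from its values on an orthonormal basis. -/
lemma sum_inner_tanBasis (A : Tan E x →L[ℝ] Tan E x) (u v : Tan E x) :
    ∑ a, ∑ b, (inner ℝ (tanBasis x a) (A (tanBasis x b)) *
      (inner ℝ u (tanBasis x a) * inner ℝ (tanBasis x b) v) : ℝ) = inner ℝ u (A v) := by
  have h : ∀ w : Tan E x, A w = ∑ b, (inner ℝ (tanBasis x b) w : ℝ) • A (tanBasis x b) := by
    intro w
    conv_lhs => rw [← (tanBasis x).sum_repr' w]
    rw [map_sum]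
    simp only [map_smul]
  rw [h, inner_sum, Finset.sum_comm]
  refine Finset.sum_congr rfl fun b _ ↦ ?_
  rw [inner_smul_right, ← (tanBasis x).sum_inner_mul_inner u, Finset.mul_sum]
  refine Finset.sum_congr rfl fun a _ ↦ ?_
  ring

omit [IsContMDiffRiemannianBundle 𝓘(ℝ, E) ∞ E (fun x : M ↦ TangentSpace 𝓘(ℝ, E) x)] in
/-- `divTorsion` has the values on the orthonormal basis from which it is built. -/
lemma divTorsion_tanBasis (b : Fin (Module.finrank ℝ (Tan E x))) :
    divTorsion F D x (tanBasis x b) = ∑ j, covTorsion F D (ext (horBasis F x j : Tan E x))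
      (ext (horBasis F x j : Tan E x)) (ext (tanBasis x b)) x := by
  simp only [divTorsion, sum_apply, ContinuousLinearMap.smulRight_apply, innerSL_apply_apply]
  rw [Finset.sum_eq_single b]
  · simp
  · intro a _ hab
    rw [(tanBasis x).inner_eq_zero hab, zero_smul]
  · simp

lemma ricciOp_adjointConn_apply (hD : IsLeviCivita D) (hF : F.IsBundleLike)
    (hF' : F.IsTotallyGeodesic D) (ε : ℝ) (η : Tan E x →L[ℝ] ℝ) (v : Tan E x) :
    ricciOp F (adjointConn F D ε) x η v = ricciOp F (bott F D) x η v -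
      (1 / ε) * inner ℝ ((flat x).symm η) (divTorsion F D x v) +
      (1 / ε) * inner ℝ ((flat x).symm η) (JSq F D x v) := by
  rw [ricciOp_apply, ricciOp_apply, ← sum_inner_tanBasis (divTorsion F D x),
    ← sum_inner_tanBasis (JSq F D x)]
  simp only [Finset.mul_sum, ← Finset.sum_sub_distrib, ← Finset.sum_add_distrib]
  refine Finset.sum_congr rfl fun a _ ↦ Finset.sum_congr rfl fun b _ ↦ ?_
  rw [ricciH_adjointConn hD hF hF', divTorsion_tanBasis, inner_JSq_comm hD hF hF']
  ring

lemma ricciOp_bott_comm (hD : IsLeviCivita D) (hF : F.IsBundleLike)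
    (hF' : F.IsTotallyGeodesic D) (η ξ : Tan E x →L[ℝ] ℝ) :
    ricciOp F (bott F D) x η ((flat x).symm ξ) = ricciOp F (bott F D) x ξ ((flat x).symm η) := by
  rw [ricciOp_apply, ricciOp_apply, Finset.sum_comm]
  refine Finset.sum_congr rfl fun a _ ↦ Finset.sum_congr rfl fun b _ ↦ ?_
  rw [ricciH_bott_comm hD hF hF', real_inner_comm (tanBasis x a) ((flat x).symm ξ),
    real_inner_comm (tanBasis x b) ((flat x).symm η)]
  ring

end Forms

end RiemannianFoliation

theorem mainTheorem7 {n m : ℕ} {E : Type*} [NormedAddCommGroup E] [NormedSpace ℝ E]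
    [FiniteDimensional ℝ E] (hdim : Module.finrank ℝ E = n + m)
    {M : Type*} [TopologicalSpace M] [T2Space M] [ChartedSpace E M] [IsManifold 𝓘(ℝ, E) ∞ M]
    [RiemannianBundle (fun x : M ↦ TangentSpace 𝓘(ℝ, E) x)]
    [IsContMDiffRiemannianBundle 𝓘(ℝ, E) ∞ E
      (fun x : M ↦ TangentSpace 𝓘(ℝ, E) x)]
    (F : RiemannianFoliation.Foliation n E M)
    (D : CovariantDerivative 𝓘(ℝ, E) E
      (fun x : M ↦ TangentSpace 𝓘(ℝ, E) x))
    (hD : RiemannianFoliation.IsLeviCivita D)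
    (hF : F.IsBundleLike) (hF' : F.IsTotallyGeodesic D) (ε : ℝ) (hε : 0 < ε) (x : M) :
    RiemannianFoliation.ricciOp F (RiemannianFoliation.adjointConn F D ε) x =
        RiemannianFoliation.ricciOp F (RiemannianFoliation.bott F D) x
        - (1 / ε) • RiemannianFoliation.onForms
            (RiemannianFoliation.metricAdjoint (RiemannianFoliation.divTorsion F D x))
        + (1 / ε) • RiemannianFoliation.onForms (RiemannianFoliation.JSq F D x) ∧
      ∀ η ξ : TangentSpace 𝓘(ℝ, E) x →L[ℝ] ℝ,
        RiemannianFoliation.ricciOp F (RiemannianFoliation.adjointConn F D ε) x η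
            ((RiemannianFoliation.flat x).symm ξ) =
          RiemannianFoliation.weitzenbockPotential F D ε x ξ
            ((RiemannianFoliation.flat x).symm η) := by
  refine ⟨?_, fun η ξ ↦ ?_⟩
  · ext η v
    rw [RiemannianFoliation.ricciOp_adjointConn_apply hD hF hF']
    simp only [add_apply, sub_apply, smul_apply, smul_eq_mul, RiemannianFoliation.onForms_apply,
      RiemannianFoliation.inner_metricAdjoint, RiemannianFoliation.inner_JSq_comm hD hF hF']
  · rw [RiemannianFoliation.ricciOp_adjointConn_apply hD hF hF',
      RiemannianFoliation.ricciOp_bott_comm hD hF hF', RiemannianFoliation.weitzenbockPotential]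
    simp only [add_apply, sub_apply, smul_apply, smul_eq_mul, RiemannianFoliation.onForms_apply]
    rw [real_inner_comm (RiemannianFoliation.divTorsion F D x _),
      real_inner_comm (RiemannianFoliation.JSq F D x _)]
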